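/- For a polynomial $P=\sum_{k=0}^n a_kX^k=a_n\prod_{k=1}^n(X-\alpha_k)\in\mathbb{C}[X]$ of degree $n\ge 1$ put $$h_{\mathrm{FS}}(P)=\tfrac1n\log|a_n|+\tfrac1{2n}\sum_{k=1}^n\log(1+|\alpha_k|^2),\qquad h_B(P)=\tfrac1n\log\max_{0\le k\le n}\frac{|a_k|}{\sqrt{\binom nk}}.$$ For $n\in\mathbb{Z}_{\ge1}$ and $r\in\mathbb{R}$ let $$\mathcal{P}_{n,r}=\{P\in\mathbb{Z}[X] : \deg P=n,\ h_B(P)\le r\},$$ which is a finite set. Let $(r_n)_{n\ge 1}$ be any sequence of real numbers. (i) If $r_n$ converges to some $\tau\in(0,\infty)$, then $$\lim_{n\to\infty}\frac1{\#\mathcal{P}_{n,r_n}}\sum_{P\in\mathcal{P}_{n,r_n}}\left|\tau+\tfrac12-h_{\mathrm{FS}}(P)\right|=0.$$ (ii) If $0<\liminf_{n\to\infty}r_n\le\limsup_{n\to\infty}r_n<\infty$, then for every continuous function $f\colon\mathbb{C}\to\mathbb{C}$ such that $\lim_{|z|\to\infty}f(z)$ exists in $\mathbb{C}$, $$\lim_{n\to\infty}\frac1{\#\mathcal{P}_{n,r_n}}\sum_{P\in\mathcal{P}_{n,r_n}}\left|\frac1n\sum_{P(z)=0}f(z)-\frac{i}{2\pi}\int_{\mathbb{C}}f(z)\frac{dz\wedge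 d\bar z}{(1+|z|^2)^2}\right|=0,$$ and in particular $$\lim_{n\to\infty}\frac1{\#\mathcal{P}_{n,r_n}}\sum_{P\in\mathcal{P}_{n,r_n}}\frac1n\sum_{P(z)=0}f(z)=\frac{i}{2\pi}\int_{\mathbb{C}}f(z)\frac{dz\wedge d\bar z}{(1+|z|^2)^2}.$$ Here the sums over $P(z)=0$ run over the complex zeros of $P$ counted with multiplicity. (The averages are defined for all sufficiently large $n$, since $X^n\in\mathcal{P}_{n,r}$ as soon as $r\ge0$.) -/

import Mathlib

open Polynomial Filter Topology

namespace PolyHeight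

/-- The Fubini--Study height
`h_FS(P) = (1/n) log |a_n| + (1/(2n)) ∑_k log (1 + |α_k|²)` of a complex polynomial of degree `n ≥ 1`
with leading coefficient `a_n` and roots `α_1, …, α_n`, listed with multiplicity. -/
noncomputable def hFS (P : ℂ[X]) : ℝ :=
  1 / (P.natDegree : ℝ) * Real.log ‖P.leadingCoeff‖
    + 1 / (2 * (P.natDegree : ℝ)) * (P.roots.map fun α => Real.log (1 + ‖α‖ ^ 2)).sum

/-- The height `h_B(P) = (1/n) log max_{0 ≤ k ≤ n} |a_k| / √(n choose k)` of a complex polynomial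
of degree `n ≥ 1` with coefficients `a_0, …, a_n` (attached to the Bombieri `∞`-norm). -/
noncomputable def hB (P : ℂ[X]) : ℝ :=
  1 / (P.natDegree : ℝ) * Real.log
    ((Finset.range (P.natDegree + 1)).sup' Finset.nonempty_range_add_one
      fun k => ‖P.coeff k‖ / √(P.natDegree.choose k : ℝ))

/-- An integer polynomial, regarded as a complex polynomial. -/
noncomputable def toC (P : ℤ[X]) : ℂ[X] := P.map (Int.castRingHom ℂ)

/-- The set of integer polynomials `P` of degree exactly `n` with `h_B(P) ≤ r`. -/
def polySet (n : ℕ) (r : ℝ) : Set ℤ[X] :=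
  {P | P.degree = (n : WithBot ℕ) ∧ hB (toC P) ≤ r}

/-- The average of `g` over the integer polynomials of degree `n` with `h_B ≤ r`. For `n ≥ 1` this
set is finite (`polySet_finite`), so the sum and the cardinality have their literal meaning. -/
noncomputable def avg {E : Type*} [AddCommGroup E] [Module ℝ E] (n : ℕ) (r : ℝ)
    (g : ℤ[X] → E) : E :=
  (1 / ((polySet n r).ncard : ℝ)) • ∑ᶠ P ∈ polySet n r, g P

/-- The normalized sum `(1/n) ∑_{P(z) = 0} f(z)` over the complex zeros, with multiplicity, of a
polynomial of degree `n`. -/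
noncomputable def zeroMean (f : ℂ → ℂ) (P : ℂ[X]) : ℂ :=
  1 / (P.natDegree : ℂ) * (P.roots.map f).sum

/-- The integral `(i/2π) ∫_ℂ f(z) dz ∧ dz̄ / (1 + |z|²)²` against the Fubini--Study measure. As
`dz ∧ dz̄ = -2i dx ∧ dy`, it is `(1/π) ∫_ℂ f(z) / (1 + |z|²)²` with respect to Lebesgue measure. -/
noncomputable def fubiniStudyIntegral (f : ℂ → ℂ) : ℂ :=
  1 / (Real.pi : ℂ) * ∫ z : ℂ, f z / (1 + (‖z‖ : ℂ) ^ 2) ^ 2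

theorem polySet_finite {n : ℕ} (hn : 1 ≤ n) (r : ℝ) : (polySet n r).Finite := by
  set B : ℕ → ℤ := fun k => ⌈Real.exp (n * r) * √(n.choose k : ℝ)⌉ with hBdef
  have hfin : (Set.univ.pi fun k : Fin (n + 1) => Set.Icc (-B k) (B k)).Finite :=
    Set.Finite.pi fun k => Set.finite_Icc _ _
  refine Set.Finite.of_injOn (f := fun P : ℤ[X] => fun k : Fin (n + 1) => P.coeff k) ?_ ?_ hfin
  · rintro P ⟨hd, hP⟩ k -
    have hnd : P.natDegree = n := natDegree_eq_of_degree_eq_some hd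
    have hP0 : P ≠ 0 := by
      rintro rfl
      simp at hd
    have hnC : (toC P).natDegree = n := by
      rw [toC, natDegree_map_eq_of_injective (RingHom.injective_int _), hnd]
    have hnpos : (0 : ℝ) < n := by exact_mod_cast hn
    simp only [hB, hnC] at hP
    set M := (Finset.range (n + 1)).sup' Finset.nonempty_range_add_one
      fun k => ‖(toC P).coeff k‖ / √(n.choose k : ℝ) with hM
    have hle : ∀ j ∈ Finset.range (n + 1), ‖(toC P).coeff j‖ / √(n.choose j : ℝ) ≤ M :=
      fun j hj => Finset.le_sup' (fun k => ‖(toC P).coeff k‖ / √(n.choose k : ℝ)) hj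
    have hMpos : 0 < M := by
      refine lt_of_lt_of_le ?_ (hle n (by simp))
      have : P.coeff n ≠ 0 := by
        rw [← hnd]
        simpa using hP0
      simpa [toC] using this
    have hMle : M ≤ Real.exp (n * r) := by
      rw [← Real.log_le_iff_le_exp hMpos]
      rw [one_div, inv_mul_le_iff₀ hnpos] at hP
      exact hP
    have hkn : (k : ℕ) ≤ n := Nat.lt_succ_iff.mp k.2
    have hch : 0 < √(n.choose k : ℝ) :=
      Real.sqrt_pos.mpr (by exact_mod_cast Nat.choose_pos hkn)
    have h1 := (hle k (by simp [hkn])).trans hMle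
    rw [div_le_iff₀ hch] at h1
    have h2 : ‖(toC P).coeff k‖ = |((P.coeff k : ℤ) : ℝ)| := by simp [toC]
    rw [h2] at h1
    have h3 : |P.coeff k| ≤ B k := by
      have : ((|P.coeff k| : ℤ) : ℝ) ≤ B k := by
        push_cast
        exact h1.trans (Int.le_ceil _)
      exact_mod_cast this
    exact ⟨(abs_le.mp h3).1, (abs_le.mp h3).2⟩
  · rintro P ⟨hP, -⟩ Q ⟨hQ, -⟩ h
    ext k
    by_cases hk : k < n + 1
    · exact congrFun h ⟨k, hk⟩
    · have hk' : n < k := by omega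
      rw [coeff_eq_zero_of_natDegree_lt, coeff_eq_zero_of_natDegree_lt]
      · rw [natDegree_eq_of_degree_eq_some hQ]; exact hk'
      · rw [natDegree_eq_of_degree_eq_some hP]; exact hk'

end PolyHeight

/-!
For a polynomial `P` of degree `n` let `D(w) = (1/n) log |P(w)| - r - log √(1 + |w|²)` be its
deviation. Everything follows from one fact: averaged over the integer polynomials with `h_B ≤ r`,
the `L¹`-norm of `D` on any disc tends to `0` (`tendsto_avg_deviation`).

*Why the deviation is small.* The condition `h_B ≤ r` says that the coefficients lie in a box,
`|a_k| ≤ exp (n r) √(n choose k)`. By Cauchy--Schwarz `D ≤ log (n + 1) / (2 n)` everywhere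
(`deviation_le`). Conversely, at a given `w` fix all coefficients of `P` but the one whose monomial
is largest at `w`: it runs through an interval of integers, and `D(w) < -η` leaves only an
exponentially small proportion of its values (`card_small_le`). At the exceptional pairs `(P, w)`
the deviation could be very negative, but as `|a_n| ≥ 1` it is bounded below by a mean of the
functions `log |α - w|` over the roots `α`, which are uniformly integrable, whence
`avg_deviation_le`.

*Why this is enough.* Let `U_ρ` be the logarithmic potential of the uniform measure on the disc of
radius `ρ`, a continuous function. By Jensen's formula the disc averages of `(1/n) log |P|` are
means over the roots of translates of `U_ρ`, up to the leading coefficient; those of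
`log √(1 + |w|²)` are integrals of the same functions against the Fubini--Study measure, because
`log √(1 + |w|²)` is its potential (`integral_fsDensity_mul_log`). Hence the integral of `D` over a
disc is the error in the equidistribution of the roots, tested on `U_ρ`
(`setIntegral_ball_deviation`). The differences `U_{2ε} - U_ε` are compactly supported bump
functions, in which the leading coefficient cancels, and convolution with them approximates every
continuous function that has a limit at infinity (`isControlled_of_tendsto`). The Fubini--Study
height is `(1/n) log |a_n|` plus the mean of `log √(1 + |z|²)` over the roots; here `U_1` absorbs
both the leading coefficient and the growth at infinity (`abs_hFS_sub_le`), and the limit `τ + 1/2`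
comes from `integral_fsDensity_mul_fsPotential`.
-/

namespace PolyHeight

section Equidistribution

open MeasureTheory Real

/-! ### The logarithmic kernel in polar coordinates -/

/-- Integrability in polar coordinates, complementing `Complex.integral_comp_polarCoord_symm`. -/
theorem integrable_polarCoord {f : ℂ → ℝ} (hm : Measurable f) (hf : Integrable f) :
    IntegrableOn (fun p : ℝ × ℝ => p.1 * f (Complex.polarCoord.symm p))
      (Set.Ioi 0 ×ˢ Set.Ioo (-π) π) := by
  have hms : Measurable (Complex.polarCoord.symm : ℝ × ℝ → ℂ) := by
    have : (Complex.polarCoord.symm : ℝ × ℝ → ℂ) =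
        fun p => (p.1 : ℂ) * (Real.cos p.2 + Real.sin p.2 * Complex.I) := by
      ext p; simp
    rw [this]; fun_prop
  refine ⟨(measurable_fst.mul (hm.comp hms)).aestronglyMeasurable, ?_⟩
  have h := Complex.lintegral_comp_polarCoord_symm (fun z => ‖f z‖ₑ)
  rw [HasFiniteIntegral]
  refine lt_of_eq_of_lt ?_ hf.2
  rw [← h, polarCoord_target]
  refine setLIntegral_congr_fun (measurableSet_Ioi.prod measurableSet_Ioo) fun p hp => ?_
  have hp1 : (0 : ℝ) < p.1 := hp.1
  simp [enorm_mul, Real.enorm_of_nonneg hp1.le]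

/-- Jensen's formula for a linear polynomial: the integral, with respect to the angle, of
`log |z - w|` over the circle `|w| = s`. -/
theorem integral_log_circle (z : ℂ) {s : ℝ} (hs : 0 < s) :
    ∫ θ in Set.Ioo (-π) π, log ‖z - Complex.polarCoord.symm (s, θ)‖ =
      2 * π * log (max ‖z‖ s) := by
  have h := circleAverage_log_norm_sub_const_eq_log_radius_add_posLog (a := z) (c := 0) hs.ne'
  rw [circleAverage_def, smul_eq_mul, inv_mul_eq_iff_eq_mul₀ (by positivity)] at h
  have hper : Function.Periodic (fun θ => log ‖circleMap 0 s θ - z‖) (2 * π) := fun θ => by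
    simp [periodic_circleMap 0 s θ]
  have h2 := hper.intervalIntegral_add_eq (-π) 0
  rw [zero_add, h, show -π + 2 * π = π by ring,
    intervalIntegral.integral_of_le (by linarith [pi_pos]), integral_Ioc_eq_integral_Ioo] at h2
  have hmax : log s + log⁺ (s⁻¹ * ‖0 - z‖) = log (max ‖z‖ s) := by
    rw [zero_sub, norm_neg]
    rcases le_total ‖z‖ s with hz | hz
    · rw [max_eq_right hz, posLog_eq_zero_iff _ |>.2, add_zero]
      rw [abs_of_nonneg (by positivity), inv_mul_le_iff₀ hs]; simpa
    · have hz' : 0 < ‖z‖ := hs.trans_le hz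
      rw [max_eq_left hz, posLog_eq_log, log_mul (by positivity) (by positivity), log_inv]
      · ring
      · rw [abs_of_nonneg (by positivity), le_inv_mul_iff₀ hs]; simpa
  rw [← hmax, ← h2]
  refine setIntegral_congr_fun measurableSet_Ioo fun θ _ => ?_
  rw [norm_sub_rev]
  congr 3
  simp [circleMap, Complex.exp_mul_I]

/-- Integration of a radial weight against the logarithmic kernel reduces to one variable. -/
theorem integral_radial_mul_log {g : ℝ → ℝ} (hg : Measurable g) (z : ℂ)
    (hi : Integrable fun w : ℂ => g ‖w‖ * log ‖z - w‖) :
    ∫ w : ℂ, g ‖w‖ * log ‖z - w‖ =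
      2 * π * ∫ s in Set.Ioi (0 : ℝ), s * g s * log (max ‖z‖ s) := by
  have hi' := integrable_polarCoord (by fun_prop) hi
  rw [← Complex.integral_comp_polarCoord_symm, polarCoord_target]
  simp only [smul_eq_mul]
  rw [Measure.volume_eq_prod] at hi' ⊢
  rw [setIntegral_prod _ hi', ← integral_const_mul]
  refine setIntegral_congr_fun measurableSet_Ioi fun s hs => ?_
  have hs : 0 < s := hs
  simp only [Complex.norm_polarCoord_symm, abs_of_pos hs, ← mul_assoc]
  rw [integral_const_mul, integral_log_circle z hs]
  ring

theorem integral_radial {g : ℝ → ℝ} : ∫ w : ℂ, g ‖w‖ = 2 * π * ∫ s in Set.Ioi (0 : ℝ), s * g s := by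
  rw [integral_fun_norm_addHaar]
  simp [measureReal_def, nsmul_eq_mul, mul_assoc]

/-- The function `1 / ‖z‖` cut off to the open unit disc: an integrable majorant, up to a constant,
of `(-log ‖z‖) ^ 2` near the origin. -/
noncomputable def logKernel (z : ℂ) : ℝ := Set.indicator (Set.Iio 1) (fun s : ℝ => s⁻¹) ‖z‖

theorem logKernel_nonneg (z : ℂ) : 0 ≤ logKernel z := by
  unfold logKernel Set.indicator
  split_ifs <;> positivity

theorem measurable_logKernel : Measurable logKernel :=
  (measurable_inv.indicator measurableSet_Iio).comp measurable_norm

theorem logKernel_of_lt {z : ℂ} (h : ‖z‖ < 1) : logKernel z = ‖z‖⁻¹ :=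
  Set.indicator_of_mem (s := Set.Iio (1 : ℝ)) h _

theorem integrable_logKernel : Integrable logKernel := by
  unfold logKernel
  rw [integrable_fun_norm_addHaar]
  simp only [Complex.finrank_real_complex, Nat.add_one_sub_one, pow_one, smul_eq_mul]
  have h : IntegrableOn (fun _ : ℝ => (1 : ℝ)) (Set.Ioo 0 1) := integrableOn_const (by simp)
  rw [← integrable_indicator_iff measurableSet_Ioo] at h
  refine (h.integrableOn (s := Set.Ioi 0)).congr_fun (fun s hs => ?_) measurableSet_Ioi
  have hs : (0 : ℝ) < s := hs
  by_cases h1 : s < 1 <;> simp [hs, h1, hs.ne']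

theorem integral_logKernel : ∫ w, logKernel w = 2 * π := by
  simp only [logKernel]
  rw [integral_radial]
  have h : ∀ s ∈ Set.Ioi (0 : ℝ), s * Set.indicator (Set.Iio 1) (fun s : ℝ => s⁻¹) s =
      Set.indicator (Set.Ioo 0 1) (fun _ => (1 : ℝ)) s := fun s hs => by
    have hs : (0 : ℝ) < s := hs
    by_cases h1 : s < 1 <;> simp [hs, h1, hs.ne']
  rw [setIntegral_congr_fun measurableSet_Ioi h, setIntegral_indicator measurableSet_Ioo,
    Set.inter_eq_right.2 Set.Ioo_subset_Ioi_self]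
  simp

theorem abs_log_norm_le (z : ℂ) : |log ‖z‖| ≤ logKernel z + ‖z‖ := by
  rcases eq_or_ne z 0 with rfl | hz
  · simpa using logKernel_nonneg 0
  have hz' : 0 < ‖z‖ := norm_pos_iff.2 hz
  rcases lt_or_ge ‖z‖ 1 with h | h
  · rw [abs_of_nonpos (log_nonpos hz'.le h.le), ← log_inv]
    have := log_le_sub_one_of_pos (inv_pos.2 hz')
    have h2 := logKernel_of_lt h
    rw [h2]; linarith
  · rw [abs_of_nonneg (log_nonneg h)]
    linarith [log_le_sub_one_of_pos hz', logKernel_nonneg z]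

/-- Uniform integrability of `-log ‖z‖` near its singularity, in a form that is stable under
averaging over translates. -/
theorem neg_log_norm_le {T : ℝ} (hT : 0 < T) (z : ℂ) : -log ‖z‖ ≤ T + 2 / T * logKernel z := by
  rcases eq_or_ne z 0 with rfl | hz
  · simp; have := logKernel_nonneg 0; positivity
  have hz' : 0 < ‖z‖ := norm_pos_iff.2 hz
  have hK := logKernel_nonneg z
  rcases lt_or_ge ‖z‖ 1 with h | h
  · have h2 := logKernel_of_lt h
    set x := -log ‖z‖ with hx
    have hx0 : 0 ≤ x := by have := log_nonpos hz'.le h.le; linarith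
    have h3 : x ^ 2 / 2 ≤ logKernel z := by
      rw [h2, ← exp_log hz', ← exp_neg, ← hx]
      linarith [quadratic_le_exp_of_nonneg hx0]
    -- `x ≤ T` or `x ≤ x ^ 2 / T`, and `x ^ 2 / 2 ≤ exp x = 1 / ‖z‖`
    have h4 : x ≤ T + x ^ 2 / T := by
      rw [← sub_nonneg]
      have : T + x ^ 2 / T - x = ((x - T / 2) ^ 2 + 3 / 4 * T ^ 2) / T := by field_simp; ring
      rw [this]; positivity
    have h5 : x ^ 2 / T ≤ 2 / T * logKernel z := by
      have : x ^ 2 / T = 2 / T * (x ^ 2 / 2) := by ring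
      rw [this]; gcongr
    linarith
  · have := log_nonneg h
    have : 0 ≤ 2 / T * logKernel z := by positivity
    linarith

theorem integrableOn_log_norm_sub (c : ℂ) (ρ : ℝ) (z : ℂ) :
    IntegrableOn (fun w => log ‖z - w‖) (Metric.ball c ρ) := by
  have h1 : Integrable fun w => logKernel (z - w) := integrable_logKernel.comp_sub_left z
  have h2 : IntegrableOn (fun w => ‖z - w‖) (Metric.ball c ρ) :=
    ((by fun_prop : Continuous fun w => ‖z - w‖).continuousOn.integrableOn_compact
      (isCompact_closedBall c ρ)).mono_set Metric.ball_subset_closedBall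
  refine (h1.integrableOn.add h2).mono'
    (by fun_prop : Measurable fun w => log ‖z - w‖).aestronglyMeasurable (ae_of_all _ fun w => ?_)
  exact abs_log_norm_le _

/-! ### Potentials of the Fubini--Study measure and of discs -/

/-- The density `1 / (π (1 + ‖z‖²)²)` of the Fubini--Study measure, a probability measure on `ℂ`,
with respect to Lebesgue measure. -/
noncomputable def fsDensity (z : ℂ) : ℝ := 1 / (π * (1 + ‖z‖ ^ 2) ^ 2)

/-- The potential `log √(1 + ‖z‖²)` of the Fubini--Study measure. -/
noncomputable def fsPotential (z : ℂ) : ℝ := log (1 + ‖z‖ ^ 2) / 2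

/-- The logarithmic potential of the uniform probability measure on the disc of radius `ρ` around
`0`, in closed form. -/
noncomputable def discPotential (ρ : ℝ) (z : ℂ) : ℝ :=
  log (max ‖z‖ ρ) - max 0 (1 - ‖z‖ ^ 2 / ρ ^ 2) / 2

theorem fsDensity_pos (z : ℂ) : 0 < fsDensity z := by unfold fsDensity; positivity

theorem continuous_fsDensity : Continuous fsDensity := by
  unfold fsDensity
  exact continuous_const.div (by fun_prop) fun z => by positivity

theorem fsPotential_nonneg (z : ℂ) : 0 ≤ fsPotential z := by
  unfold fsPotential
  have := log_nonneg (show 1 ≤ 1 + ‖z‖ ^ 2 by nlinarith [sq_nonneg ‖z‖])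
  positivity

theorem continuous_fsPotential : Continuous fsPotential := by
  unfold fsPotential
  exact (Continuous.log (by fun_prop) fun z => by positivity).div_const _

theorem continuous_discPotential {ρ : ℝ} (hρ : 0 < ρ) : Continuous (discPotential ρ) := by
  unfold discPotential
  exact (Continuous.log (by fun_prop) fun z => (lt_max_of_lt_right hρ).ne').sub (by fun_prop)

theorem hasDerivAt_neg_inv_one_add_sq (s : ℝ) :
    HasDerivAt (fun s : ℝ => -(1 / (2 * (1 + s ^ 2)))) (s / (1 + s ^ 2) ^ 2) s := by
  have h : HasDerivAt (fun s : ℝ => 2 * (1 + s ^ 2)) (2 * (2 * s)) s := by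
    simpa using ((hasDerivAt_pow 2 s).const_add 1).const_mul 2
  have h2 := (h.inv (by positivity)).neg
  simp only [one_div]
  refine h2.congr_deriv ?_
  field_simp

theorem tendsto_one_add_sq : Tendsto (fun s : ℝ => 1 + s ^ 2) atTop atTop :=
  tendsto_atTop_add_const_left _ _ (tendsto_pow_atTop two_ne_zero)

theorem tendsto_neg_inv_one_add_sq :
    Tendsto (fun s : ℝ => -(1 / (2 * (1 + s ^ 2)))) atTop (𝓝 0) := by
  have h := (tendsto_one_add_sq.const_mul_atTop (two_pos)).inv_tendsto_atTop.neg
  simpa using h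

theorem integrable_fsDensity : Integrable fsDensity := by
  have h := integrable_rpow_neg_one_add_norm_sq (E := ℂ) (μ := volume) (r := 4) (by simp; norm_num)
  convert h.const_mul (1 / π) using 2 with z
  unfold fsDensity
  rw [show -(4 : ℝ) / 2 = -(2 : ℕ) by norm_num, rpow_neg (by positivity), rpow_natCast]
  field_simp

theorem integral_fsDensity : ∫ z, fsDensity z = 1 := by
  unfold fsDensity
  rw [integral_radial (g := fun s => 1 / (π * (1 + s ^ 2) ^ 2))]
  have h := integral_Ioi_of_hasDerivAt_of_nonneg' (a := 0)
    (fun s _ => hasDerivAt_neg_inv_one_add_sq s)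
    (fun s hs => by have : (0 : ℝ) < s := hs; positivity) tendsto_neg_inv_one_add_sq
  have h2 : ∀ s : ℝ, s * (1 / (π * (1 + s ^ 2) ^ 2)) = 1 / π * (s / (1 + s ^ 2) ^ 2) := fun s => by
    field_simp
  simp only [h2]
  rw [integral_const_mul, h]
  have := pi_pos.ne'
  field_simp
  norm_num

theorem integrable_fsDensity_mul_norm : Integrable fun z => fsDensity z * ‖z‖ := by
  have h := integrable_rpow_neg_one_add_norm_sq (E := ℂ) (μ := volume) (r := 3) (by simp; norm_num)
  refine (h.const_mul (1 / π)).mono' (by unfold fsDensity; fun_prop) (ae_of_all _ fun z => ?_)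
  have hp := fsDensity_pos z
  rw [norm_of_nonneg (by positivity), fsDensity]
  set y := 1 + ‖z‖ ^ 2 with hy
  have hy0 : 0 < y := by positivity
  rw [show -(3 : ℝ) / 2 = 1 / 2 - (2 : ℕ) by norm_num, rpow_sub hy0, ← sqrt_eq_rpow, rpow_natCast]
  have : ‖z‖ ≤ √y := le_sqrt_of_sq_le (by linarith)
  calc 1 / (π * y ^ 2) * ‖z‖ ≤ 1 / (π * y ^ 2) * √y := by gcongr
    _ = _ := by field_simp

theorem fsDensity_le_one (z : ℂ) : fsDensity z ≤ 1 := by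
  unfold fsDensity
  rw [div_le_one (by positivity)]
  have : 1 ≤ (1 + ‖z‖ ^ 2) ^ 2 := by nlinarith [sq_nonneg ‖z‖]
  nlinarith [pi_gt_three]

theorem abs_fsDensity_mul_log_le (w z : ℂ) :
    |fsDensity w * log ‖z - w‖| ≤ logKernel (z - w) + fsDensity w * ‖z‖ + fsDensity w * ‖w‖ := by
  have hp := fsDensity_pos w
  have hK := logKernel_nonneg (z - w)
  rw [abs_mul, abs_of_pos hp]
  calc _ ≤ fsDensity w * (logKernel (z - w) + (‖z‖ + ‖w‖)) := by
        gcongr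
        exact (abs_log_norm_le _).trans (by gcongr; exact norm_sub_le _ _)
    _ ≤ _ := by nlinarith [mul_le_mul_of_nonneg_right (fsDensity_le_one w) hK]

theorem measurable_log_norm_sub : Measurable fun p : ℂ × ℂ => log ‖p.1 - p.2‖ := by fun_prop

theorem integrable_fsDensity_mul_log (z : ℂ) : Integrable fun w => fsDensity w * log ‖z - w‖ :=
  (((integrable_logKernel.comp_sub_left z).add (integrable_fsDensity.mul_const ‖z‖)).add
    integrable_fsDensity_mul_norm).mono'
    (continuous_fsDensity.measurable.mul (by fun_prop)).aestronglyMeasurable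
    (ae_of_all _ fun w => abs_fsDensity_mul_log_le w z)

theorem continuous_sq_mul_log : Continuous fun s : ℝ => s ^ 2 * log s := by
  have h := continuous_id.mul continuous_mul_log
  refine h.congr fun s => ?_
  simp; ring

theorem integral_log_max_mul {t : ℝ} (ht : 0 ≤ t)
    (hi : IntegrableOn (fun s => s / (1 + s ^ 2) ^ 2 * log (max t s)) (Set.Ioi 0)) :
    ∫ s in Set.Ioi (0 : ℝ), s / (1 + s ^ 2) ^ 2 * log (max t s) = log (1 + t ^ 2) / 4 := by
  rw [← Set.Ioc_union_Ioi_eq_Ioi ht] at hi ⊢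
  rw [setIntegral_union (Set.Ioc_disjoint_Ioi le_rfl) measurableSet_Ioi
    (hi.mono_set Set.subset_union_left) (hi.mono_set Set.subset_union_right)]
  have h1 : ∫ s in Set.Ioc 0 t, s / (1 + s ^ 2) ^ 2 * log (max t s) =
      log t * (1 / 2 - 1 / (2 * (1 + t ^ 2))) := by
    have : ∀ s ∈ Set.Ioc 0 t, s / (1 + s ^ 2) ^ 2 * log (max t s) =
        log t * (s / (1 + s ^ 2) ^ 2) := fun s hs => by rw [max_eq_left hs.2]; ring
    rw [setIntegral_congr_fun measurableSet_Ioc this, integral_const_mul,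
      ← intervalIntegral.integral_of_le ht,
      intervalIntegral.integral_eq_sub_of_hasDerivAt
        (fun s _ => hasDerivAt_neg_inv_one_add_sq s)]
    · ring
    · exact (Continuous.div (by fun_prop) (by fun_prop)
        fun s => by positivity).intervalIntegrable _ _
  have h2 : ∫ s in Set.Ioi t, s / (1 + s ^ 2) ^ 2 * log (max t s) =
      0 - (t ^ 2 * log t / (2 * (1 + t ^ 2)) - log (1 + t ^ 2) / 4) := by
    have hi2 := hi.mono_set (s := Set.Ioi t) Set.subset_union_right
    have : ∀ s ∈ Set.Ioi t, s / (1 + s ^ 2) ^ 2 * log (max t s) =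
        s / (1 + s ^ 2) ^ 2 * log s := fun s hs => by rw [max_eq_right (le_of_lt hs)]
    rw [setIntegral_congr_fun measurableSet_Ioi this]
    rw [integrableOn_congr_fun this measurableSet_Ioi] at hi2
    refine integral_Ioi_of_hasDerivAt_of_tendsto
      (f := fun s => s ^ 2 * log s / (2 * (1 + s ^ 2)) - log (1 + s ^ 2) / 4) ?_ ?_ hi2 ?_
    · refine Continuous.continuousWithinAt (Continuous.sub ?_ ?_)
      · exact continuous_sq_mul_log.div (by fun_prop) fun s => by positivity
      · exact (Continuous.log (by fun_prop) fun z => by positivity).div_const _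
    · intro s hs
      have hs0 : 0 < s := ht.trans_lt hs
      have hd : HasDerivAt (fun s : ℝ => 1 + s ^ 2) (2 * s) s := by
        simpa using (hasDerivAt_pow 2 s).const_add 1
      have ha := (((hasDerivAt_pow 2 s).mul (hasDerivAt_log hs0.ne')).div (hd.const_mul 2)
        (by positivity)).sub ((hd.log (by positivity)).div_const 4)
      refine ha.congr_deriv ?_
      simp
      field_simp
      ring
    · have e : (fun s : ℝ => s ^ 2 * log s / (2 * (1 + s ^ 2)) - log (1 + s ^ 2) / 4) =ᶠ[atTop]
          fun s => -(log s / s ^ 2) * (s ^ 2 / (2 * (1 + s ^ 2))) - log (1 + (s ^ 2)⁻¹) / 4 := by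
        filter_upwards [eventually_gt_atTop 0] with s hs
        have : log (1 + (s ^ 2)⁻¹) = log (1 + s ^ 2) - 2 * log s := by
          rw [show 1 + (s ^ 2)⁻¹ = (1 + s ^ 2) / s ^ 2 by field_simp; ring,
            log_div (by positivity) (by positivity), log_pow]
          norm_num
        rw [this]
        field_simp
        ring
      rw [tendsto_congr' e]
      have l1 : Tendsto (fun s : ℝ => log s / s ^ 2) atTop (𝓝 0) := by
        have := (isLittleO_log_rpow_atTop (r := 2) (by norm_num)).tendsto_div_nhds_zero
        simpa using this
      have l2 : Tendsto (fun s : ℝ => (s ^ 2)⁻¹) atTop (𝓝 0) :=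
        (tendsto_pow_atTop two_ne_zero).inv_tendsto_atTop
      have l3 : Tendsto (fun s : ℝ => log (1 + (s ^ 2)⁻¹) / 4) atTop (𝓝 0) := by
        have := ((l2.const_add 1).log (by norm_num)).div_const 4
        simpa using this
      have l4 : Tendsto (fun s : ℝ => -(log s / s ^ 2) * (s ^ 2 / (2 * (1 + s ^ 2))))
          atTop (𝓝 0) := by
        refine squeeze_zero_norm (a := fun s => ‖log s / s ^ 2‖) (fun s => ?_)
          (by simpa using l1.norm)
        rw [norm_mul, norm_neg]
        refine mul_le_of_le_one_right (norm_nonneg _) ?_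
        rw [norm_of_nonneg (by positivity), div_le_one (by positivity)]
        nlinarith [sq_nonneg s]
      simpa using l4.sub l3
  rw [h1, h2]
  field_simp
  ring

/-- The logarithmic potential of the Fubini--Study measure is `log √(1 + ‖z‖²)`. -/
theorem integral_fsDensity_mul_log (z : ℂ) :
    ∫ w, fsDensity w * log ‖z - w‖ = fsPotential z := by
  have hi := integrable_fsDensity_mul_log z
  have e : ∀ s : ℝ, ∀ m, s * (1 / (π * (1 + s ^ 2) ^ 2)) * m =
      1 / π * (s / (1 + s ^ 2) ^ 2 * m) := fun s m => by field_simp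
  have hi2 : IntegrableOn (fun s => s / (1 + s ^ 2) ^ 2 * log (max ‖z‖ s)) (Set.Ioi 0) := by
    have h := integrable_polarCoord (f := fun w => fsDensity w * log ‖z - w‖)
      (continuous_fsDensity.measurable.mul (by fun_prop)) hi
    rw [Measure.volume_eq_prod, IntegrableOn, ← Measure.prod_restrict] at h
    have h := h.integral_prod_left.const_mul (1 / 2)
    refine IntegrableOn.congr_fun h (fun s hs => ?_) measurableSet_Ioi
    have hs : 0 < s := hs
    simp only [fsDensity, Complex.norm_polarCoord_symm, abs_of_pos hs, ← mul_assoc]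
    rw [integral_const_mul, integral_log_circle z hs]
    field_simp
  unfold fsDensity at hi ⊢
  rw [integral_radial_mul_log (g := fun s => 1 / (π * (1 + s ^ 2) ^ 2)) (by fun_prop) z hi]
  simp only [e]
  rw [integral_const_mul, integral_log_max_mul (norm_nonneg z) hi2, fsPotential]
  field_simp
  ring

theorem integrable_fsDensity_mul_fsPotential : Integrable fun z => fsDensity z * fsPotential z := by
  refine integrable_fsDensity_mul_norm.mono'
    (continuous_fsDensity.mul continuous_fsPotential).aestronglyMeasurable (ae_of_all _ fun z => ?_)
  have hp := fsDensity_pos z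
  have hq := fsPotential_nonneg z
  rw [norm_of_nonneg (by positivity)]
  gcongr
  unfold fsPotential
  have : log (1 + ‖z‖ ^ 2) ≤ log ((1 + ‖z‖) ^ 2) :=
    log_le_log (by positivity) (by nlinarith [norm_nonneg z])
  rw [log_pow] at this
  have h2 := log_le_sub_one_of_pos (show 0 < 1 + ‖z‖ by positivity)
  push_cast at this
  linarith

theorem integral_fsDensity_mul_fsPotential : ∫ z, fsDensity z * fsPotential z = 1 / 2 := by
  unfold fsDensity fsPotential
  rw [integral_radial (g := fun s => 1 / (π * (1 + s ^ 2) ^ 2) * (log (1 + s ^ 2) / 2))]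
  have hd : ∀ s ∈ Set.Ici (0 : ℝ), HasDerivAt (fun s : ℝ => -((1 + log (1 + s ^ 2)) / (1 + s ^ 2)))
      (2 * s * log (1 + s ^ 2) / (1 + s ^ 2) ^ 2) s := fun s _ => by
    have hd : HasDerivAt (fun s : ℝ => 1 + s ^ 2) (2 * s) s := by
      simpa using (hasDerivAt_pow 2 s).const_add 1
    refine ((((hd.log (by positivity)).const_add 1).div hd (by positivity)).neg).congr_deriv ?_
    field_simp
    ring
  have hlim : Tendsto (fun s : ℝ => -((1 + log (1 + s ^ 2)) / (1 + s ^ 2))) atTop (𝓝 0) := by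
    have h1 : Tendsto (fun y : ℝ => -((1 + log y) / y)) atTop (𝓝 0) := by
      have a := (isLittleO_log_id_atTop).tendsto_div_nhds_zero
      have b := tendsto_inv_atTop_zero (𝕜 := ℝ)
      have := (b.add a).neg
      simp only [id, add_zero, neg_zero] at this
      refine this.congr fun y => ?_
      ring
    exact h1.comp tendsto_one_add_sq
  have h := integral_Ioi_of_hasDerivAt_of_nonneg' (a := 0) hd
    (fun s hs => by
      have : (0 : ℝ) < s := hs
      have := log_nonneg (show 1 ≤ 1 + s ^ 2 by nlinarith [sq_nonneg s])
      positivity) hlim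
  have h2 : ∀ s : ℝ, s * (1 / (π * (1 + s ^ 2) ^ 2) * (log (1 + s ^ 2) / 2)) =
      1 / (4 * π) * (2 * s * log (1 + s ^ 2) / (1 + s ^ 2) ^ 2) := fun s => by
    field_simp; norm_num
  simp only [h2]
  rw [integral_const_mul, h]
  have := pi_pos.ne'
  field_simp
  norm_num

theorem integral_mul_log_max {t ρ : ℝ} (ht : 0 ≤ t) (hρ : 0 < ρ) :
    ∫ s in (0 : ℝ)..ρ, s * log (max t s) =
      ρ ^ 2 / 2 * (log (max t ρ) - max 0 (1 - t ^ 2 / ρ ^ 2) / 2) := by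
  have hlog : ∀ b : ℝ, 0 ≤ b → b ≤ t → ∫ s in (0 : ℝ)..b, s * log (max t s) =
      b ^ 2 / 2 * log t := fun b hb hbt => by
    rw [intervalIntegral.integral_congr (g := fun s => s * log t) fun s hs => ?_]
    · rw [intervalIntegral.integral_mul_const, integral_id]; ring
    · rw [Set.uIcc_of_le hb] at hs
      simp [max_eq_left (hs.2.trans hbt)]
  rcases le_total ρ t with h | h
  · rw [hlog ρ hρ.le h, max_eq_left h, max_eq_left]
    · ring
    · rw [sub_nonpos, one_le_div (by positivity)]; gcongr
  · have hc : ∀ a b : ℝ, a ≤ b → 0 ≤ a →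
        IntervalIntegrable (fun s => s * log (max t s)) volume a b := fun a b hab ha => by
      rcases ht.eq_or_lt with rfl | ht'
      · refine (continuous_mul_log.intervalIntegrable a b).congr fun s hs => ?_
        rw [Set.uIoc_of_le hab] at hs
        simp [max_eq_right (ha.trans hs.1.le)]
      · exact (continuous_id.mul (Continuous.log (by fun_prop)
          fun s => (lt_max_of_lt_left ht').ne')).intervalIntegrable _ _
    rw [← intervalIntegral.integral_add_adjacent_intervals (hc 0 t ht le_rfl) (hc t ρ h ht),
      hlog t ht le_rfl]
    have h2 : ∫ s in t..ρ, s * log (max t s) =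
        (ρ ^ 2 * log ρ / 2 - ρ ^ 2 / 4) - (t ^ 2 * log t / 2 - t ^ 2 / 4) := by
      rw [intervalIntegral.integral_congr (g := fun s => s * log s) fun s hs => ?_]
      · refine intervalIntegral.integral_eq_sub_of_hasDerivAt_of_le h
          (f := fun s => s ^ 2 * log s / 2 - s ^ 2 / 4) ?_ ?_
          (continuous_mul_log.intervalIntegrable _ _)
        · exact ((continuous_sq_mul_log.div_const 2).sub (by fun_prop)).continuousOn
        · intro s hs
          have hs0 : 0 < s := ht.trans_lt hs.1
          refine ((((hasDerivAt_pow 2 s).mul (hasDerivAt_log hs0.ne')).div_const 2).sub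
            ((hasDerivAt_pow 2 s).div_const 4)).congr_deriv ?_
          simp
          field_simp
          ring
      · rw [Set.uIcc_of_le h] at hs
        simp [max_eq_right hs.1]
    rw [h2, max_eq_right h, max_eq_right]
    · field_simp; ring
    · rw [sub_nonneg, div_le_one (by positivity)]; gcongr

/-- `discPotential` is the logarithmic potential of the uniform measure on a disc. -/
theorem setIntegral_ball_log (c z : ℂ) {ρ : ℝ} (hρ : 0 < ρ) :
    ∫ w in Metric.ball c ρ, log ‖z - w‖ = π * ρ ^ 2 * discPotential ρ (z - c) := by
  have h0 : ∀ z : ℂ, ∫ w in Metric.ball 0 ρ, log ‖z - w‖ = π * ρ ^ 2 * discPotential ρ z := by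
    intro z
    have e : ∀ w : ℂ, (Metric.ball 0 ρ).indicator (fun w => log ‖z - w‖) w =
        (Set.Iio ρ).indicator 1 ‖w‖ * log ‖z - w‖ := fun w => by
      by_cases h : ‖w‖ < ρ <;> simp [h]
    have hi := integrableOn_log_norm_sub 0 ρ z
    rw [← integrable_indicator_iff Metric.isOpen_ball.measurableSet, funext e] at hi
    rw [← integral_indicator Metric.isOpen_ball.measurableSet, funext e,
      integral_radial_mul_log (measurable_one.indicator measurableSet_Iio) z hi]
    have e2 : ∀ s : ℝ, s * (Set.Iio ρ).indicator 1 s * log (max ‖z‖ s) =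
        (Set.Iio ρ).indicator (fun s => s * log (max ‖z‖ s)) s := fun s => by
      by_cases h : s < ρ <;> simp [h]
    simp only [e2]
    rw [setIntegral_indicator measurableSet_Iio, Set.Ioi_inter_Iio, ← integral_Ioc_eq_integral_Ioo,
      ← intervalIntegral.integral_of_le hρ.le, integral_mul_log_max (norm_nonneg z) hρ,
      discPotential]
    ring
  rw [← h0]
  rw [← integral_indicator Metric.isOpen_ball.measurableSet,
    ← integral_indicator Metric.isOpen_ball.measurableSet,
    ← integral_add_right_eq_self _ c]
  congr 1 with w
  by_cases h : ‖w‖ < ρ <;> simp [h, sub_sub, add_comm]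

/-- Fubini's theorem for the logarithmic kernel: the energy pairing of the Fubini--Study measure
with a disc can be computed on either side. -/
theorem integral_fsDensity_mul_discPotential (c : ℂ) {ρ : ℝ} (hρ : 0 < ρ) :
    Integrable (fun z => fsDensity z * discPotential ρ (z - c)) ∧
    ∫ z, fsDensity z * discPotential ρ (z - c) =
      1 / (π * ρ ^ 2) * ∫ w in Metric.ball c ρ, fsPotential w := by
  have hB : MeasurableSet (Metric.ball c ρ) := Metric.isOpen_ball.measurableSet
  set μ := (volume : Measure ℂ).restrict (Metric.ball c ρ) with hμ
  have hn : IntegrableOn (fun z : ℂ => ‖z‖) (Metric.ball c ρ) :=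
    (continuous_norm.continuousOn.integrableOn_compact
      (isCompact_closedBall c ρ)).mono_set Metric.ball_subset_closedBall
  have h1 : IntegrableOn (fun _ : ℂ => (1 : ℝ)) (Metric.ball c ρ) :=
    integrableOn_const Metric.isBounded_ball.measure_lt_top.ne
  have hK : Integrable (fun p : ℂ × ℂ => logKernel (p.1 - p.2)) (μ.prod volume) := by
    have hm : Measurable fun p : ℂ × ℂ => logKernel (p.1 - p.2) :=
      measurable_logKernel.comp (measurable_fst.sub measurable_snd)
    rw [integrable_prod_iff hm.aestronglyMeasurable]
    refine ⟨ae_of_all _ fun w => integrable_logKernel.comp_sub_left w, ?_⟩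
    simp only [norm_of_nonneg (logKernel_nonneg _)]
    simp only [fun w : ℂ => integral_sub_left_eq_self logKernel volume w]
    simpa using h1.mul_const _
  have hint : Integrable (fun p : ℂ × ℂ => fsDensity p.2 * log ‖p.1 - p.2‖) (μ.prod volume) := by
    refine ((hK.add ((Integrable.mul_prod hn integrable_fsDensity))).add
      (Integrable.mul_prod h1 integrable_fsDensity_mul_norm)).mono' ?_ ?_
    · exact ((continuous_fsDensity.measurable.comp measurable_snd).mul
        measurable_log_norm_sub).aestronglyMeasurable
    · refine ae_of_all _ fun p => (abs_fsDensity_mul_log_le p.2 p.1).trans_eq ?_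
      simp only [Pi.add_apply, one_mul]
      ring
  have e : ∀ z, ∫ w in Metric.ball c ρ, fsDensity z * log ‖w - z‖ =
      π * ρ ^ 2 * (fsDensity z * discPotential ρ (z - c)) := fun z => by
    rw [integral_const_mul]
    simp only [norm_sub_rev _ z]
    rw [setIntegral_ball_log c z hρ]
    ring
  have hp : 0 < π * ρ ^ 2 := by positivity
  constructor
  · have := hint.integral_prod_right
    simp only [hμ, e] at this
    rwa [integrable_const_mul_iff (isUnit_iff_ne_zero.2 hp.ne')] at this
  · have := integral_integral_swap (f := fun w z => fsDensity z * log ‖w - z‖) hint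
    simp only [hμ, e, integral_fsDensity_mul_log, integral_const_mul] at this
    rw [this]
    field_simp

/-! ### Deviation and means over the roots -/

/-- The deviation of `(1/n) log |P|`, for a polynomial `P` of degree `n`, from its expected value
`r + log √(1 + ‖w‖²)`. Where `P` vanishes it is finite, by the convention `log 0 = 0`; this
concerns finitely many points only. -/
noncomputable def deviation (r : ℝ) (P : ℂ[X]) (w : ℂ) : ℝ :=
  log ‖P.eval w‖ / P.natDegree - r - fsPotential w

/-- The mean `(1/n) ∑ g(α)` of a real function over the roots of a polynomial of degree `n`. -/
noncomputable def rootMean (g : ℂ → ℝ) (P : ℂ[X]) : ℝ := (P.roots.map g).sum / P.natDegree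

theorem card_roots_complex (P : ℂ[X]) : P.roots.card = P.natDegree :=
  (IsAlgClosed.splits P).natDegree_eq_card_roots.symm

theorem log_norm_eval {P : ℂ[X]} (hP : P ≠ 0) {w : ℂ} (hw : P.eval w ≠ 0) :
    log ‖P.eval w‖ = log ‖P.leadingCoeff‖ + (P.roots.map fun α => log ‖α - w‖).sum := by
  have h := (IsAlgClosed.splits P).eval_eq_prod_roots w
  rw [h, norm_mul, log_mul (by simpa) (by rw [h] at hw; simpa using right_ne_zero_of_mul hw)]
  congr 1
  have hn : ∀ α ∈ P.roots, α - w ≠ 0 := fun α hα h0 => hw (by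
    rw [← sub_eq_zero.1 h0]; exact (mem_roots hP).1 hα)
  generalize P.roots = s at hn
  induction s using Multiset.induction with
  | empty => simp
  | cons a s ih =>
    have ha : a - w ≠ 0 := hn a (by simp)
    have hs : ∀ α ∈ s, α - w ≠ 0 := fun α h => hn α (by simp [h])
    have hne : ‖(s.map fun α => w - α).prod‖ ≠ 0 := by
      rw [norm_ne_zero_iff, Ne, Multiset.prod_eq_zero_iff]
      simp only [Multiset.mem_map, not_exists, not_and]
      intro α hα h0
      exact hs α hα (by rw [← neg_sub, h0, neg_zero])
    simp only [Multiset.map_cons, Multiset.prod_cons, Multiset.sum_cons, norm_mul]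
    rw [log_mul (by rw [norm_sub_rev]; simpa using ha) hne, ih hs, norm_sub_rev]

theorem ae_eval_ne_zero {P : ℂ[X]} (hP : P ≠ 0) : ∀ᵐ w : ℂ, P.eval w ≠ 0 := by
  rw [ae_iff]
  refine (Set.Finite.subset (P.roots.toFinset.finite_toSet) fun w hw => ?_).measure_zero _
  simpa [hP] using hw

theorem setIntegral_ball_sum_log (s : Multiset ℂ) (c : ℂ) {ρ : ℝ} (hρ : 0 < ρ) :
    IntegrableOn (fun w => (s.map fun α => log ‖α - w‖).sum) (Metric.ball c ρ) ∧
    ∫ w in Metric.ball c ρ, (s.map fun α => log ‖α - w‖).sum =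
      π * ρ ^ 2 * (s.map fun α => discPotential ρ (α - c)).sum := by
  induction s using Multiset.induction with
  | empty => simp
  | cons a s ih =>
    simp only [Multiset.map_cons, Multiset.sum_cons]
    refine ⟨(integrableOn_log_norm_sub c ρ a).add ih.1, ?_⟩
    rw [integral_add (integrableOn_log_norm_sub c ρ a) ih.1, ih.2, setIntegral_ball_log c a hρ]
    ring

theorem integrableOn_fsPotential (c : ℂ) (ρ : ℝ) : IntegrableOn fsPotential (Metric.ball c ρ) :=
  (continuous_fsPotential.continuousOn.integrableOn_compact
    (isCompact_closedBall c ρ)).mono_set Metric.ball_subset_closedBall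

theorem setIntegral_ball_const (c : ℂ) {ρ : ℝ} (hρ : 0 ≤ ρ) (a : ℝ) :
    ∫ _ in Metric.ball c ρ, a = π * ρ ^ 2 * a := by
  simp [measureReal_def, hρ]
  left; ring

theorem integrableOn_ball_const (c : ℂ) (ρ a : ℝ) :
    IntegrableOn (fun _ => a) (Metric.ball c ρ) :=
  integrableOn_const Metric.isBounded_ball.measure_lt_top.ne

/-- The integral of the deviation over a disc is a statistic of the roots alone, up to the
normalization by the leading coefficient. -/
theorem setIntegral_ball_deviation {P : ℂ[X]} (hn : 0 < P.natDegree) (r : ℝ) (c : ℂ) {ρ : ℝ}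
    (hρ : 0 < ρ) :
    IntegrableOn (deviation r P) (Metric.ball c ρ) ∧
    ∫ w in Metric.ball c ρ, deviation r P w = π * ρ ^ 2 *
      (log ‖P.leadingCoeff‖ / P.natDegree + rootMean (fun z => discPotential ρ (z - c)) P - r -
        ∫ z, fsDensity z * discPotential ρ (z - c)) := by
  have hP : P ≠ 0 := by rintro rfl; simp at hn
  obtain ⟨h1, h2⟩ := setIntegral_ball_sum_log P.roots c hρ
  have hae : (fun w => log ‖P.leadingCoeff‖ / P.natDegree +
      (P.roots.map fun α => log ‖α - w‖).sum / P.natDegree - r - fsPotential w)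
      =ᵐ[volume.restrict (Metric.ball c ρ)] deviation r P := by
    filter_upwards [ae_restrict_of_ae (ae_eval_ne_zero hP)] with w hw
    rw [deviation, log_norm_eval hP hw, add_div]
  have hconst := integrableOn_ball_const c ρ
  have i1 : IntegrableOn (fun w => log ‖P.leadingCoeff‖ / P.natDegree +
      (P.roots.map fun α => log ‖α - w‖).sum / P.natDegree) (Metric.ball c ρ) :=
    (hconst _).add (h1.div_const _)
  have i2 : IntegrableOn (fun w => log ‖P.leadingCoeff‖ / P.natDegree +
      (P.roots.map fun α => log ‖α - w‖).sum / P.natDegree - r) (Metric.ball c ρ) :=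
    i1.sub (hconst r)
  have i3 := i2.sub (integrableOn_fsPotential c ρ)
  refine ⟨i3.congr hae, ?_⟩
  rw [← integral_congr_ae hae, integral_sub i2 (integrableOn_fsPotential c ρ),
    integral_sub i1 (hconst r), integral_add (hconst _) (h1.div_const _),
    setIntegral_ball_const c hρ.le, setIntegral_ball_const c hρ.le, integral_div, h2,
    (integral_fsDensity_mul_discPotential c hρ).2, rootMean]
  field_simp

theorem integrableOn_deviation {P : ℂ[X]} (hn : 0 < P.natDegree) (r : ℝ) (c : ℂ) (ρ : ℝ) :
    IntegrableOn (deviation r P) (Metric.ball c ρ) :=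
  (setIntegral_ball_deviation hn r c (ρ := max ρ 1) (by positivity)).1.mono_set
    (Metric.ball_subset_ball (le_max_left _ _))

theorem abs_rootMean_discPotential_le {P : ℂ[X]} (hn : 0 < P.natDegree) (r : ℝ) {c : ℂ} {ρ R : ℝ}
    (hρ : 0 < ρ) (hR : ‖c‖ + ρ ≤ R) :
    |log ‖P.leadingCoeff‖ / P.natDegree + rootMean (fun z => discPotential ρ (z - c)) P - r -
        ∫ z, fsDensity z * discPotential ρ (z - c)| ≤
      1 / (π * ρ ^ 2) * ∫ w in Metric.ball 0 R, |deviation r P w| := by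
  have h := (setIntegral_ball_deviation hn r c hρ).2
  have hp : 0 < π * ρ ^ 2 := by positivity
  have hsub : Metric.ball c ρ ⊆ Metric.ball 0 R := Metric.ball_subset_ball' (by simpa [add_comm ρ])
  rw [one_div, ← div_eq_inv_mul, le_div_iff₀' hp, ← abs_of_pos (a := π * ρ ^ 2) hp, ← abs_mul, ← h]
  refine (abs_integral_le_integral_abs).trans ?_
  exact setIntegral_mono_set (integrableOn_deviation hn r 0 R).abs
    (ae_of_all _ fun _ => abs_nonneg _) hsub.eventuallyLE

/-- A continuous radial bump function supported in the disc of radius `2 ε`. As a difference of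
potentials of discs, its mean over the roots of a polynomial is a difference of disc averages of
`log |P|`. -/
noncomputable def bump (ε : ℝ) (z : ℂ) : ℝ := discPotential (2 * ε) z - discPotential ε z

theorem continuous_bump {ε : ℝ} (hε : 0 < ε) : Continuous (bump ε) :=
  (continuous_discPotential (by positivity)).sub (continuous_discPotential hε)

theorem discPotential_of_le {ρ : ℝ} (hρ : 0 < ρ) {z : ℂ} (h : ρ ≤ ‖z‖) :
    discPotential ρ z = log ‖z‖ := by
  rw [discPotential, max_eq_left h, max_eq_left]
  · simp
  · rw [sub_nonpos, one_le_div (by positivity)]; gcongr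

theorem discPotential_of_ge {ρ : ℝ} (hρ : 0 < ρ) {z : ℂ} (h : ‖z‖ ≤ ρ) :
    discPotential ρ z = log ρ - (1 - ‖z‖ ^ 2 / ρ ^ 2) / 2 := by
  rw [discPotential, max_eq_right h, max_eq_right]
  rw [sub_nonneg, div_le_one (by positivity)]; gcongr

theorem bump_eq_zero {ε : ℝ} (hε : 0 < ε) {z : ℂ} (h : 2 * ε ≤ ‖z‖) : bump ε z = 0 := by
  rw [bump, discPotential_of_le (by positivity) h, discPotential_of_le hε (by linarith), sub_self]

theorem bump_nonneg {ε : ℝ} (hε : 0 < ε) (z : ℂ) : 0 ≤ bump ε z := by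
  rcases le_total (2 * ε) ‖z‖ with h | h
  · rw [bump_eq_zero hε h]
  rw [bump, discPotential_of_ge (by positivity) h]
  rcases le_total ε ‖z‖ with h2 | h2
  · have hz : 0 < ‖z‖ := hε.trans_le h2
    rw [discPotential_of_le hε h2]
    have h3 := log_le_sub_one_of_pos (show 0 < (‖z‖ / (2 * ε)) ^ 2 by positivity)
    rw [log_pow, log_div hz.ne' (by positivity), div_pow] at h3
    push_cast at h3
    linarith
  · rw [discPotential_of_ge hε h2, log_mul two_ne_zero hε.ne']
    have h3 : ‖z‖ ^ 2 / ε ^ 2 ≤ 1 := by rw [div_le_one (by positivity)]; gcongr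
    have h4 : ‖z‖ ^ 2 / (2 * ε) ^ 2 = ‖z‖ ^ 2 / ε ^ 2 / 4 := by field_simp; norm_num
    have := log_two_gt_d9
    rw [h4]
    linarith

theorem hasCompactSupport_bump {ε : ℝ} (hε : 0 < ε) : HasCompactSupport (bump ε) :=
  HasCompactSupport.intro (isCompact_closedBall 0 (2 * ε)) fun z hz =>
    bump_eq_zero hε (by simpa using (not_le.1 (by simpa using hz)).le)

theorem integrable_bump {ε : ℝ} (hε : 0 < ε) : Integrable (bump ε) :=
  (continuous_bump hε).integrable_of_hasCompactSupport (hasCompactSupport_bump hε)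

theorem integral_bump_pos {ε : ℝ} (hε : 0 < ε) : 0 < ∫ z, bump ε z := by
  refine (continuous_bump hε).integral_pos_of_hasCompactSupport_nonneg_nonzero
    (hasCompactSupport_bump hε) (bump_nonneg hε) (x := 0) ?_
  rw [bump, discPotential_of_ge (by positivity) (by simp; positivity),
    discPotential_of_ge hε (by simp; positivity), log_mul two_ne_zero hε.ne']
  have := log_pos one_lt_two
  simp only [norm_zero]
  norm_num

theorem abs_rootMean_bump_le {P : ℂ[X]} (hn : 0 < P.natDegree) (r : ℝ) {c : ℂ} {ε R : ℝ}
    (hε : 0 < ε) (hR : ‖c‖ + 2 * ε ≤ R) :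
    |rootMean (fun z => bump ε (z - c)) P - ∫ z, fsDensity z * bump ε (z - c)| ≤
      2 / (π * ε ^ 2) * ∫ w in Metric.ball 0 R, |deviation r P w| := by
  have h1 := abs_rootMean_discPotential_le hn r (c := c) (R := R) hε (by linarith)
  have h2 := abs_rootMean_discPotential_le hn r (c := c) (R := R) (ρ := 2 * ε) (by positivity) hR
  have hI : ∫ z, fsDensity z * bump ε (z - c) = (∫ z, fsDensity z * discPotential (2 * ε) (z - c)) -
      ∫ z, fsDensity z * discPotential ε (z - c) := by
    rw [← integral_sub (integral_fsDensity_mul_discPotential c (by positivity)).1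
      (integral_fsDensity_mul_discPotential c hε).1]
    simp only [bump, mul_sub]
  have hm : rootMean (fun z => bump ε (z - c)) P =
      rootMean (fun z => discPotential (2 * ε) (z - c)) P -
        rootMean (fun z => discPotential ε (z - c)) P := by
    simp only [rootMean, bump, Multiset.sum_map_sub, sub_div]
  have hN : 0 ≤ ∫ w in Metric.ball 0 R, |deviation r P w| := by positivity
  have h3 : 1 / (π * (2 * ε) ^ 2) * (∫ w in Metric.ball 0 R, |deviation r P w|) ≤
      1 / (π * ε ^ 2) * ∫ w in Metric.ball 0 R, |deviation r P w| := by
    gcongr; linarith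
  rw [hI, hm, show 2 / (π * ε ^ 2) = 1 / (π * ε ^ 2) + 1 / (π * ε ^ 2) by ring, add_mul]
  rw [abs_le] at *
  constructor <;> linarith

/-! ### Approximation of test functions -/

theorem fubiniStudyIntegral_eq (f : ℂ → ℂ) :
    fubiniStudyIntegral f = ∫ z, (fsDensity z : ℂ) * f z := by
  rw [fubiniStudyIntegral, ← integral_const_mul]
  congr 1 with z
  simp only [fsDensity]
  push_cast
  rw [div_mul_eq_mul_div, one_mul, one_div, inv_mul_eq_div, div_div, mul_comm]

theorem integrable_fsDensity_mul {f : ℂ → ℂ} (hf : Continuous f) {B : ℝ} (hB : ∀ z, ‖f z‖ ≤ B) :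
    Integrable fun z => (fsDensity z : ℂ) * f z :=
  integrable_fsDensity.ofReal.mul_bdd hf.aestronglyMeasurable (ae_of_all _ hB)

theorem norm_fubiniStudyIntegral_le {f : ℂ → ℂ} {B : ℝ} (hB : ∀ z, ‖f z‖ ≤ B) :
    ‖fubiniStudyIntegral f‖ ≤ B := by
  rw [fubiniStudyIntegral_eq]
  refine (norm_integral_le_of_norm_le (integrable_fsDensity.mul_const B)
    (ae_of_all _ fun z => ?_)).trans_eq ?_
  · rw [norm_mul, Complex.norm_real, norm_of_nonneg (fsDensity_pos z).le]
    gcongr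
    · exact (fsDensity_pos z).le
    · exact hB z
  · rw [integral_mul_const, integral_fsDensity, one_mul]

theorem norm_zeroMean_le {f : ℂ → ℂ} {B : ℝ} (hB : ∀ z, ‖f z‖ ≤ B) {P : ℂ[X]}
    (hn : 0 < P.natDegree) : ‖zeroMean f P‖ ≤ B := by
  have h : ‖(P.roots.map f).sum‖ ≤ P.natDegree * B := by
    rw [← card_roots_complex]
    induction P.roots using Multiset.induction with
    | empty => simp
    | cons a s ih =>
      simp only [Multiset.map_cons, Multiset.sum_cons, Multiset.card_cons]
      push_cast
      linarith [norm_add_le (f a) (s.map f).sum, hB a]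
  have hn' : (0 : ℝ) < P.natDegree := by exact_mod_cast hn
  rw [zeroMean, norm_mul, norm_div, norm_one, Complex.norm_natCast, one_div, inv_mul_le_iff₀ hn']
  exact h

theorem zeroMean_sub (f g : ℂ → ℂ) (P : ℂ[X]) :
    zeroMean (fun z => f z - g z) P = zeroMean f P - zeroMean g P := by
  simp only [zeroMean, Multiset.sum_map_sub, mul_sub]

theorem zeroMean_const (a : ℂ) {P : ℂ[X]} (hn : 0 < P.natDegree) :
    zeroMean (fun _ => a) P = a := by
  have hn' : (P.natDegree : ℂ) ≠ 0 := by exact_mod_cast hn.ne'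
  simp [zeroMean, card_roots_complex, hn']

theorem fubiniStudyIntegral_const (a : ℂ) : fubiniStudyIntegral (fun _ => a) = a := by
  rw [fubiniStudyIntegral_eq, integral_mul_const, integral_complex_ofReal, integral_fsDensity]
  simp

theorem fubiniStudyIntegral_sub {f g : ℂ → ℂ} (hf : Integrable fun z => (fsDensity z : ℂ) * f z)
    (hg : Integrable fun z => (fsDensity z : ℂ) * g z) :
    fubiniStudyIntegral (fun z => f z - g z) = fubiniStudyIntegral f - fubiniStudyIntegral g := by
  simp only [fubiniStudyIntegral_eq, mul_sub]
  exact integral_sub hf hg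

/-- A test function is controlled if its mean over the roots of a polynomial differs from its
Fubini--Study integral by little more than a multiple of the `L¹`-norm of the deviation over some
disc, uniformly in the polynomial. -/
def IsControlled (f : ℂ → ℂ) : Prop :=
  ∀ ε > 0, ∃ C R : ℝ, ∀ (P : ℂ[X]) (r : ℝ), 0 < P.natDegree →
    ‖zeroMean f P - fubiniStudyIntegral f‖ ≤
      ε + C * ∫ w in Metric.ball 0 R, |deviation r P w|

/-- The convolution of a function with a bump, up to normalization. -/
noncomputable def mollify (ε : ℝ) (f : ℂ → ℂ) (z : ℂ) : ℂ := ∫ c, f c * (bump ε (z - c) : ℂ)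

theorem multiset_sum_mollify {f : ℂ → ℂ} (hf : Continuous f) (hs : HasCompactSupport f) {ε : ℝ}
    (hε : 0 < ε) (s : Multiset ℂ) :
    Integrable (fun c => f c * ((s.map fun α => bump ε (α - c)).sum : ℂ)) ∧
    (s.map (mollify ε f)).sum = ∫ c, f c * ((s.map fun α => bump ε (α - c)).sum : ℂ) := by
  induction s using Multiset.induction with
  | empty => simp
  | cons a s ih =>
    have ha : Integrable fun c => f c * (bump ε (a - c) : ℂ) := by
      refine Continuous.integrable_of_hasCompactSupport ?_ hs.mul_right
      have := continuous_bump hε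
      fun_prop
    simp only [Multiset.map_cons, Multiset.sum_cons, Complex.ofReal_add, mul_add]
    refine ⟨ha.add ih.1, ?_⟩
    rw [integral_add ha ih.1, ih.2, mollify]

theorem exists_bump_le {ε : ℝ} (hε : 0 < ε) : ∃ B, ∀ z, ‖bump ε z‖ ≤ B :=
  (continuous_bump hε).bounded_above_of_compact_support (hasCompactSupport_bump hε)

theorem integral_fsDensity_mul_mollify {f : ℂ → ℂ} (hf : Continuous f) (hs : HasCompactSupport f)
    {ε : ℝ} (hε : 0 < ε) :
    Integrable (fun z => (fsDensity z : ℂ) * mollify ε f z) ∧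
    Integrable (fun c => f c * ((∫ z, fsDensity z * bump ε (z - c) : ℝ) : ℂ)) ∧
    fubiniStudyIntegral (mollify ε f) =
      ∫ c, f c * ((∫ z, fsDensity z * bump ε (z - c) : ℝ) : ℂ) := by
  obtain ⟨B, hB⟩ := exists_bump_le hε
  have hfi : Integrable f := hf.integrable_of_hasCompactSupport hs
  have hint : Integrable (fun p : ℂ × ℂ => (fsDensity p.1 : ℂ) * f p.2 * (bump ε (p.1 - p.2) : ℂ))
      (volume.prod volume) := by
    refine (Integrable.mul_prod integrable_fsDensity.ofReal hfi).mul_bdd (c := B) ?_ ?_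
    · have := continuous_bump hε
      exact Continuous.aestronglyMeasurable (by fun_prop)
    · exact ae_of_all _ fun p => by simpa using hB _
  have e1 : ∀ z, ∫ c, (fsDensity z : ℂ) * f c * (bump ε (z - c) : ℂ) =
      (fsDensity z : ℂ) * mollify ε f z := fun z => by
    simp only [mul_assoc, mollify]
    rw [integral_const_mul]
  have e2 : ∀ c, ∫ z, (fsDensity z : ℂ) * f c * (bump ε (z - c) : ℂ) =
      f c * ((∫ z, fsDensity z * bump ε (z - c) : ℝ) : ℂ) := fun c => by
    rw [← integral_complex_ofReal, ← integral_const_mul]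
    congr 1 with z
    push_cast
    ring
  refine ⟨?_, ?_, ?_⟩
  · simpa only [e1] using hint.integral_prod_left
  · simpa only [e2] using hint.integral_prod_right
  · have := integral_integral_swap
      (f := fun z c => (fsDensity z : ℂ) * f c * (bump ε (z - c) : ℂ)) hint
    simp only [e1, e2] at this
    rw [fubiniStudyIntegral_eq, this]

/-- The error in the equidistribution of the roots, tested on a mollified function, is an average of
the errors for translated bumps, hence bounded by the deviation on a disc. -/
theorem norm_zeroMean_mollify_le {f : ℂ → ℂ} (hf : Continuous f) (hs : HasCompactSupport f)
    {ε : ℝ} (hε : 0 < ε) :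
    ∃ C R : ℝ, ∀ (P : ℂ[X]) (r : ℝ), 0 < P.natDegree →
      ‖zeroMean (mollify ε f) P - fubiniStudyIntegral (mollify ε f)‖ ≤
        C * ∫ w in Metric.ball 0 R, |deviation r P w| := by
  obtain ⟨R₀, hR₀⟩ := hs.isCompact.isBounded.exists_norm_le
  refine ⟨(∫ c, ‖f c‖) * (2 / (π * ε ^ 2)), R₀ + 2 * ε, fun P r hn => ?_⟩
  obtain ⟨h1, h2⟩ := multiset_sum_mollify hf hs hε P.roots
  obtain ⟨-, h3, h4⟩ := integral_fsDensity_mul_mollify hf hs hε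
  have h5 : zeroMean (mollify ε f) P =
      ∫ c, f c * ((rootMean (fun z => bump ε (z - c)) P : ℝ) : ℂ) := by
    rw [zeroMean, h2, ← integral_const_mul]
    congr 1 with c
    simp only [rootMean]
    push_cast
    ring
  have h6 : Integrable fun c => f c * ((rootMean (fun z => bump ε (z - c)) P : ℝ) : ℂ) := by
    refine (h1.const_mul (1 / (P.natDegree : ℂ))).congr (ae_of_all _ fun c => ?_)
    simp only [rootMean]
    push_cast
    ring
  rw [h5, h4, ← integral_sub h6 h3]
  have hfi : Integrable f := hf.integrable_of_hasCompactSupport hs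
  refine (norm_integral_le_of_norm_le (hfi.norm.mul_const (2 / (π * ε ^ 2) *
    ∫ w in Metric.ball 0 (R₀ + 2 * ε), |deviation r P w|)) (ae_of_all _ fun c => ?_)).trans_eq ?_
  · rw [← mul_sub, norm_mul, ← Complex.ofReal_sub, Complex.norm_real, norm_eq_abs]
    by_cases hc : f c = 0
    · simp [hc]
    · gcongr
      exact abs_rootMean_bump_le hn r hε
        (by have := hR₀ c (subset_tsupport f hc); linarith)
  · rw [integral_mul_const]
    ring

theorem norm_mollify_sub_le {f : ℂ → ℂ} (hf : Continuous f) {ε δ : ℝ} (hε : 0 < ε)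
    (hδ : ∀ z w, ‖z - w‖ ≤ 2 * ε → ‖f z - f w‖ ≤ δ) (z : ℂ) :
    ‖mollify ε f z - (∫ w, bump ε w : ℝ) * f z‖ ≤ (∫ w, bump ε w) * δ := by
  have hb := continuous_bump hε
  have e1 : mollify ε f z = ∫ c, f (z - c) * (bump ε c : ℂ) := by
    rw [mollify, ← integral_sub_left_eq_self _ volume z]
    simp
  have e2 : (∫ w, bump ε w : ℝ) * f z = ∫ c, f z * (bump ε c : ℂ) := by
    rw [integral_const_mul, integral_complex_ofReal, mul_comm]
  have hcs : HasCompactSupport fun c => (bump ε c : ℂ) :=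
    (hasCompactSupport_bump hε).comp_left Complex.ofReal_zero
  have i1 : Integrable fun c => f (z - c) * (bump ε c : ℂ) :=
    Continuous.integrable_of_hasCompactSupport (by fun_prop) hcs.mul_left
  have i2 : Integrable fun c => f z * (bump ε c : ℂ) :=
    Continuous.integrable_of_hasCompactSupport (by fun_prop) hcs.mul_left
  rw [e1, e2, ← integral_sub i1 i2]
  refine (norm_integral_le_of_norm_le ((integrable_bump hε).mul_const δ)
    (ae_of_all _ fun c => ?_)).trans_eq (integral_mul_const _ _)
  rw [← sub_mul, norm_mul, Complex.norm_real, norm_of_nonneg (bump_nonneg hε c), mul_comm]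
  rcases le_total (2 * ε) ‖c‖ with hc | hc
  · simp [bump_eq_zero hε hc]
  · exact mul_le_mul_of_nonneg_left (hδ _ _ (by simpa using hc)) (bump_nonneg hε c)

/-- Being controlled is stable under uniform approximation. -/
theorem isControlled_of_approx {f : ℂ → ℂ}
    (hf : Integrable fun z => (fsDensity z : ℂ) * f z)
    (h : ∀ ε > 0, ∃ g : ℂ → ℂ, (Integrable fun z => (fsDensity z : ℂ) * g z) ∧
      IsControlled g ∧ ∀ z, ‖f z - g z‖ ≤ ε) : IsControlled f := by
  intro ε hε
  obtain ⟨g, hgi, hg, hfg⟩ := h (ε / 3) (by positivity)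
  obtain ⟨C, R, hCR⟩ := hg (ε / 3) (by positivity)
  refine ⟨C, R, fun P r hn => ?_⟩
  have h1 := norm_zeroMean_le hfg hn
  have h2 := norm_fubiniStudyIntegral_le hfg
  have h3 := hCR P r hn
  rw [zeroMean_sub] at h1
  rw [fubiniStudyIntegral_sub hf hgi] at h2
  have h4 : zeroMean f P - fubiniStudyIntegral f = (zeroMean f P - zeroMean g P) -
      (fubiniStudyIntegral f - fubiniStudyIntegral g) +
      (zeroMean g P - fubiniStudyIntegral g) := by ring
  rw [h4]
  refine (norm_add_le _ _).trans ?_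
  linarith [norm_sub_le (zeroMean f P - zeroMean g P)
    (fubiniStudyIntegral f - fubiniStudyIntegral g)]

theorem zeroMean_const_mul (a : ℂ) (f : ℂ → ℂ) (P : ℂ[X]) :
    zeroMean (fun z => a * f z) P = a * zeroMean f P := by
  simp only [zeroMean, Multiset.sum_map_mul_left]
  ring

theorem fubiniStudyIntegral_const_mul (a : ℂ) (f : ℂ → ℂ) :
    fubiniStudyIntegral (fun z => a * f z) = a * fubiniStudyIntegral f := by
  simp only [fubiniStudyIntegral_eq, ← integral_const_mul, mul_left_comm a]

theorem isControlled_of_hasCompactSupport {f : ℂ → ℂ} (hf : Continuous f)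
    (hs : HasCompactSupport f) : IsControlled f := by
  obtain ⟨B, hB⟩ := hf.bounded_above_of_compact_support hs
  refine isControlled_of_approx (integrable_fsDensity_mul hf hB) fun δ hδ => ?_
  obtain ⟨η, hη, hfη⟩ := Metric.uniformContinuous_iff.1
    (hs.uniformContinuous_of_continuous hf) δ hδ
  have hε : 0 < η / 4 := by positivity
  obtain ⟨C, R, hCR⟩ := norm_zeroMean_mollify_le hf hs hε
  have hI := integral_bump_pos hε
  set I := ∫ w, bump (η / 4) w with hIdef
  refine ⟨fun z => (I : ℂ)⁻¹ * mollify (η / 4) f z, ?_, ?_, fun z => ?_⟩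
  · simpa only [mul_left_comm] using
      (integral_fsDensity_mul_mollify hf hs hε).1.const_mul (I : ℂ)⁻¹
  · intro ε hε
    refine ⟨I⁻¹ * C, R, fun P r hn => ?_⟩
    rw [zeroMean_const_mul, fubiniStudyIntegral_const_mul, ← mul_sub, norm_mul, norm_inv,
      Complex.norm_real, norm_of_nonneg hI.le, mul_assoc]
    have := mul_le_mul_of_nonneg_left (hCR P r hn) (inv_nonneg.2 hI.le)
    linarith
  · have h := norm_mollify_sub_le hf hε (δ := δ) (fun z w hzw => by
      have := @hfη z w (by rw [dist_eq_norm]; linarith)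
      rw [dist_eq_norm] at this
      exact this.le) z
    rw [← hIdef] at h
    have hI' : (I : ℂ) ≠ 0 := by exact_mod_cast hI.ne'
    have e : f z - (I : ℂ)⁻¹ * mollify (η / 4) f z =
        -((I : ℂ)⁻¹ * (mollify (η / 4) f z - I * f z)) := by
      field_simp
      ring
    rw [e, norm_neg, norm_mul, norm_inv, Complex.norm_real, norm_of_nonneg hI.le,
      inv_mul_le_iff₀ hI]
    exact h

/-- Every continuous function on the Riemann sphere is controlled. -/
theorem isControlled_of_tendsto {f : ℂ → ℂ} (hf : Continuous f) {L : ℂ}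
    (hL : Tendsto f (cocompact ℂ) (𝓝 L)) : IsControlled f := by
  -- It is enough to treat `f - L`, which vanishes at infinity.
  have key : ∀ g : ℂ → ℂ, Continuous g → Tendsto g (cocompact ℂ) (𝓝 0) →
      (∃ B, ∀ z, ‖g z‖ ≤ B) ∧ IsControlled g := by
    intro g hg hg0
    have htail : ∀ ε > 0, ∃ R : ℝ, ∀ z, R ≤ ‖z‖ → ‖g z‖ < ε := fun ε hε => by
      have h1 : ∀ᶠ z in cocompact ℂ, ‖g z‖ < ε := by
        filter_upwards [hg0.eventually (Metric.ball_mem_nhds 0 hε)] with z hz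
        simpa using hz
      rw [← Metric.cobounded_eq_cocompact, ← comap_norm_atTop, eventually_comap,
        eventually_atTop] at h1
      obtain ⟨R, hR⟩ := h1
      exact ⟨R, fun z hz => hR _ hz z rfl⟩
    have hbdd : ∃ B, ∀ z, ‖g z‖ ≤ B := by
      obtain ⟨R, hR⟩ := htail 1 one_pos
      obtain ⟨B, hB⟩ :=
        (isCompact_closedBall (0 : ℂ) R).exists_bound_of_continuousOn hg.continuousOn
      refine ⟨max B 1, fun z => ?_⟩
      rcases le_total R ‖z‖ with h | h
      · exact (hR z h).le.trans (le_max_right _ _)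
      · exact (hB z (by simpa using h)).trans (le_max_left _ _)
    refine ⟨hbdd, ?_⟩
    obtain ⟨B, hB⟩ := hbdd
    refine isControlled_of_approx (integrable_fsDensity_mul hg hB) fun ε hε => ?_
    obtain ⟨R, hR⟩ := htail ε hε
    -- a continuous cutoff, equal to `1` on the disc of radius `R` and to `0` off that of radius
    -- `R + 1`
    set χ : ℂ → ℝ := fun z => max 0 (min 1 (R + 1 - ‖z‖)) with hχ
    have hχ0 : ∀ z, 0 ≤ χ z := fun z => le_max_left _ _
    have hχ1 : ∀ z, χ z ≤ 1 := fun z => max_le zero_le_one (min_le_left _ _)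
    have hχc : Continuous χ := by fun_prop
    have hcont : Continuous fun z => g z * (χ z : ℂ) := by fun_prop
    have hcs : HasCompactSupport fun z => g z * (χ z : ℂ) := by
      refine HasCompactSupport.intro (isCompact_closedBall 0 (R + 1)) fun z hz => ?_
      have : R + 1 < ‖z‖ := by simpa using hz
      have h0 : χ z = 0 := max_eq_left ((min_le_right _ _).trans (by linarith))
      simp [h0]
    obtain ⟨B', hB'⟩ := hcont.bounded_above_of_compact_support hcs
    refine ⟨_, integrable_fsDensity_mul hcont hB', isControlled_of_hasCompactSupport hcont hcs,
      fun z => ?_⟩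
    have e : g z - g z * (χ z : ℂ) = g z * ((1 - χ z : ℝ) : ℂ) := by push_cast; ring
    rw [e, norm_mul, Complex.norm_real, norm_of_nonneg (by linarith [hχ1 z])]
    rcases le_total R ‖z‖ with h | h
    · exact (mul_le_of_le_one_right (norm_nonneg _) (by linarith [hχ0 z])).trans (hR z h).le
    · have h1 : χ z = 1 := by
        simp only [hχ]
        rw [min_eq_left (by linarith), max_eq_right zero_le_one]
      simpa [h1] using hε.le
  obtain ⟨⟨B, hB⟩, hc⟩ := key (fun z => f z - L) (hf.sub continuous_const)
    (by simpa using hL.sub_const L)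
  intro ε hε
  obtain ⟨C, R, hCR⟩ := hc ε hε
  refine ⟨C, R, fun P r hn => ?_⟩
  have h := hCR P r hn
  have i1 : Integrable fun z => (fsDensity z : ℂ) * f z :=
    integrable_fsDensity_mul hf (B := B + ‖L‖) fun z => by
      have := norm_add_le (f z - L) L
      rw [sub_add_cancel] at this
      linarith [hB z]
  have i2 : Integrable fun z => (fsDensity z : ℂ) * L := integrable_fsDensity.ofReal.mul_const L
  rw [zeroMean_sub, fubiniStudyIntegral_sub i1 i2, zeroMean_const L hn,
    fubiniStudyIntegral_const] at h
  simpa using h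

theorem tendsto_fsPotential_sub_discPotential :
    Tendsto (fun z => fsPotential z - discPotential 1 z) (cocompact ℂ) (𝓝 0) := by
  have h1 : Tendsto (fun t : ℝ => log (1 + (t ^ 2)⁻¹) / 2) atTop (𝓝 0) := by
    have l2 : Tendsto (fun t : ℝ => (t ^ 2)⁻¹) atTop (𝓝 0) :=
      (tendsto_pow_atTop two_ne_zero).inv_tendsto_atTop
    have := ((l2.const_add 1).log (by norm_num)).div_const 2
    simpa using this
  have hnorm : Tendsto (fun z : ℂ => ‖z‖) (cocompact ℂ) atTop := tendsto_norm_cocompact_atTop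
  refine (h1.comp hnorm).congr' ?_
  filter_upwards [hnorm.eventually_ge_atTop 1] with z hz
  have hz0 : 0 < ‖z‖ := one_pos.trans_le hz
  rw [discPotential_of_le one_pos hz, fsPotential]
  simp only [Function.comp]
  rw [show 1 + (‖z‖ ^ 2)⁻¹ = (1 + ‖z‖ ^ 2) / ‖z‖ ^ 2 by field_simp; ring,
    log_div (by positivity) (by positivity), log_pow]
  push_cast
  ring

theorem hFS_eq (P : ℂ[X]) :
    hFS P = log ‖P.leadingCoeff‖ / P.natDegree + rootMean fsPotential P := by
  have h : fsPotential = fun z => log (1 + ‖z‖ ^ 2) / 2 := rfl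
  rw [hFS, rootMean, h, Multiset.sum_map_div]
  ring

theorem zeroMean_ofReal (g : ℂ → ℝ) (P : ℂ[X]) :
    zeroMean (fun z => (g z : ℂ)) P = (rootMean g P : ℝ) := by
  have h := map_multiset_sum Complex.ofRealHom (P.roots.map g)
  rw [Multiset.map_map] at h
  simp only [zeroMean, rootMean]
  push_cast
  simp only [Complex.ofRealHom_eq_coe] at h
  rw [h, one_div, inv_mul_eq_div]
  rfl

theorem fubiniStudyIntegral_ofReal (g : ℂ → ℝ) :
    fubiniStudyIntegral (fun z => (g z : ℂ)) = (∫ z, fsDensity z * g z : ℝ) := by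
  rw [fubiniStudyIntegral_eq, ← integral_complex_ofReal]
  push_cast
  rfl

/-- The Fubini--Study height is close to `r + 1/2` when the deviation is small. The height is the
mean of the unbounded function `log √(1 + ‖z‖²)` over the roots, but subtracting the potential of
the unit disc leaves a function that is continuous at infinity. -/
theorem abs_hFS_sub_le {ε : ℝ} (hε : 0 < ε) :
    ∃ C R : ℝ, ∀ (P : ℂ[X]) (r : ℝ), 0 < P.natDegree →
      |r + 1 / 2 - hFS P| ≤ ε + C * (∫ w in Metric.ball 0 R, |deviation r P w|) +
        1 / π * ∫ w in Metric.ball 0 1, |deviation r P w| := by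
  have hcont : Continuous fun z => ((fsPotential z - discPotential 1 z : ℝ) : ℂ) :=
    Complex.continuous_ofReal.comp
      (continuous_fsPotential.sub (continuous_discPotential one_pos))
  have hlim : Tendsto (fun z => ((fsPotential z - discPotential 1 z : ℝ) : ℂ))
      (cocompact ℂ) (𝓝 0) := by
    rw [← Complex.ofReal_zero]
    exact (Complex.continuous_ofReal.tendsto 0).comp tendsto_fsPotential_sub_discPotential
  obtain ⟨C, R, hCR⟩ := isControlled_of_tendsto hcont hlim ε hε
  refine ⟨C, R, fun P r hn => ?_⟩
  have h1 := hCR P r hn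
  rw [zeroMean_ofReal, fubiniStudyIntegral_ofReal, ← Complex.ofReal_sub, Complex.norm_real,
    norm_eq_abs] at h1
  have h2 := abs_rootMean_discPotential_le hn r (c := 0) (R := 1) one_pos (by simp)
  have h3 : rootMean (fun z => fsPotential z - discPotential 1 z) P =
      rootMean fsPotential P - rootMean (discPotential 1) P := by
    simp only [rootMean, Multiset.sum_map_sub, sub_div]
  have hdisc := (integral_fsDensity_mul_discPotential 0 one_pos).1
  simp only [sub_zero, one_pow, mul_one] at h2 hdisc
  have h4 : ∫ z, fsDensity z * (fsPotential z - discPotential 1 z) =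
      1 / 2 - ∫ z, fsDensity z * discPotential 1 z := by
    simp only [mul_sub]
    rw [integral_sub integrable_fsDensity_mul_fsPotential hdisc, integral_fsDensity_mul_fsPotential]
  rw [h3, h4] at h1
  rw [hFS_eq]
  rw [abs_le] at *
  constructor <;> linarith

/-! ### Lattice points and anti-concentration -/

theorem natDegree_toC (P : ℤ[X]) : (toC P).natDegree = P.natDegree :=
  natDegree_map_eq_of_injective (RingHom.injective_int _) P

/-- The polynomials of degree `n` with `h_B ≤ r` are the lattice points of a box, with nonzero
leading coefficient. -/
theorem mem_polySet_iff {n : ℕ} (hn : 1 ≤ n) {r : ℝ} {P : ℤ[X]} :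
    P ∈ polySet n r ↔ (∀ k, n < k → P.coeff k = 0) ∧ P.coeff n ≠ 0 ∧
      ∀ k ≤ n, |(P.coeff k : ℝ)| ≤ exp (n * r) * √(n.choose k : ℝ) := by
  have hdeg : P.degree = (n : WithBot ℕ) ↔ (∀ k, n < k → P.coeff k = 0) ∧ P.coeff n ≠ 0 := by
    constructor
    · intro h
      exact ⟨fun k hk => coeff_eq_zero_of_degree_lt (by rw [h]; exact_mod_cast hk),
        coeff_ne_zero_of_eq_degree h⟩
    · rintro ⟨h1, h2⟩
      exact le_antisymm ((degree_le_iff_coeff_zero _ _).2 fun k hk => h1 k (by exact_mod_cast hk))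
        (le_degree_of_ne_zero h2)
  rw [polySet, Set.mem_ofPred_eq, hdeg, and_assoc]
  refine and_congr_right fun h1 => and_congr_right fun h2 => ?_
  have hnd : (toC P).natDegree = n := by
    rw [natDegree_toC]; exact natDegree_eq_of_degree_eq_some (hdeg.2 ⟨h1, h2⟩)
  have hn0 : (0 : ℝ) < n := by exact_mod_cast hn
  have hcoeff : ∀ k, ‖(toC P).coeff k‖ = |(P.coeff k : ℝ)| := fun k => by simp [toC]
  have hpos : 0 < (Finset.range (n + 1)).sup' Finset.nonempty_range_add_one
      fun k => |(P.coeff k : ℝ)| / √(n.choose k : ℝ) := by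
    rw [Finset.lt_sup'_iff]
    exact ⟨n, by simp, by simpa using h2⟩
  simp only [hB, hnd, hcoeff]
  rw [one_div, inv_mul_le_iff₀ hn0, log_le_iff_le_exp hpos, Finset.sup'_le_iff]
  simp only [Finset.mem_range, Nat.lt_succ_iff]
  refine forall₂_congr fun k hk => ?_
  rw [div_le_iff₀ (sqrt_pos.2 (by exact_mod_cast Nat.choose_pos hk))]

theorem X_pow_mem_polySet {n : ℕ} (hn : 1 ≤ n) {r : ℝ} (hr : 0 ≤ r) :
    (X ^ n : ℤ[X]) ∈ polySet n r := by
  rw [mem_polySet_iff hn]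
  refine ⟨fun k hk => by simp [coeff_X_pow, hk.ne'], by simp, fun k hk => ?_⟩
  rcases eq_or_ne k n with rfl | h
  · simpa using mul_nonneg (Nat.cast_nonneg k) hr
  · simp [coeff_X_pow, h]; positivity

theorem sum_choose_mul_pow (n : ℕ) (x : ℝ) :
    ∑ k ∈ Finset.range (n + 1), (√(n.choose k : ℝ) * x ^ k) ^ 2 = (1 + x ^ 2) ^ n := by
  rw [add_comm 1, add_pow]
  refine Finset.sum_congr rfl fun k _ => ?_
  rw [mul_pow, sq_sqrt (Nat.cast_nonneg _), one_pow]
  ring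

theorem eval_toC_eq_sum {n : ℕ} {P : ℤ[X]} (h : ∀ k, n < k → P.coeff k = 0) (w : ℂ) :
    (toC P).eval w = ∑ k ∈ Finset.range (n + 1), (P.coeff k : ℂ) * w ^ k := by
  rw [eval_eq_sum_range' (n := n + 1)]
  · simp [toC]
  · rw [natDegree_toC, Nat.lt_succ_iff, natDegree_le_iff_coeff_eq_zero]
    exact h

/-- Cauchy--Schwarz bound for the values of a polynomial with coefficients in the box. -/
theorem norm_eval_le {n : ℕ} (hn : 1 ≤ n) {r : ℝ} {P : ℤ[X]} (hP : P ∈ polySet n r) (w : ℂ) :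
    ‖(toC P).eval w‖ ≤ exp (n * r) * (√(n + 1) * √((1 + ‖w‖ ^ 2) ^ n)) := by
  obtain ⟨h1, -, h3⟩ := (mem_polySet_iff hn).1 hP
  rw [eval_toC_eq_sum h1]
  calc _ ≤ ∑ k ∈ Finset.range (n + 1), exp (n * r) * (√(n.choose k : ℝ) * ‖w‖ ^ k) := by
        refine norm_sum_le_of_le _ fun k hk => ?_
        rw [norm_mul, norm_pow, Complex.norm_intCast, ← mul_assoc]
        gcongr
        exact h3 k (Nat.lt_succ_iff.1 (Finset.mem_range.1 hk))
    _ ≤ _ := by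
        rw [← Finset.mul_sum]
        gcongr
        rw [← sqrt_mul (by positivity), ← sum_choose_mul_pow]
        refine le_sqrt_of_sq_le ?_
        have := sq_sum_le_card_mul_sum_sq (s := Finset.range (n + 1))
          (f := fun k => √(n.choose k : ℝ) * ‖w‖ ^ k)
        simpa using this

theorem log_sqrt_pow (n : ℕ) (w : ℂ) :
    log √((1 + ‖w‖ ^ 2) ^ n) = n * fsPotential w := by
  rw [log_sqrt (by positivity), log_pow, fsPotential]
  ring

theorem deviation_le {n : ℕ} (hn : 1 ≤ n) {r : ℝ} (hr : 0 ≤ r) {P : ℤ[X]} (hP : P ∈ polySet n r)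
    (w : ℂ) : deviation r (toC P) w ≤ log (n + 1) / (2 * n) := by
  have hnd : (toC P).natDegree = n := by
    rw [natDegree_toC]; exact natDegree_eq_of_degree_eq_some hP.1
  have hn0 : (0 : ℝ) < n := by exact_mod_cast hn
  have hlog : 0 ≤ log ((n : ℝ) + 1) := log_nonneg (by linarith)
  rw [deviation, hnd]
  by_cases h0 : (toC P).eval w = 0
  · have := fsPotential_nonneg w
    have : 0 ≤ log ((n : ℝ) + 1) / (2 * n) := by positivity
    simp only [h0, norm_zero, log_zero, zero_div]
    linarith
  · have h := log_le_log (norm_pos_iff.2 h0) (norm_eval_le hn hP w)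
    rw [log_mul (by positivity) (by positivity), log_mul (by positivity) (by positivity),
      log_exp, log_sqrt_pow, log_sqrt (by positivity)] at h
    have : log ‖(toC P).eval w‖ / n ≤ (n * r + (log (n + 1) / 2 + n * fsPotential w)) / n := by
      gcongr
    have e : (n * r + (log (n + 1) / 2 + n * fsPotential w)) / n =
        r + fsPotential w + log (n + 1) / (2 * n) := by
      field_simp
      ring
    linarith

/-- Some monomial carries, up to a factor `√(n + 1)`, the whole size that a polynomial in the box
can have at a point. -/
theorem exists_large_term (n : ℕ) (x : ℝ) (hx : 0 ≤ x) :
    ∃ k ≤ n, √((1 + x ^ 2) ^ n) ≤ √(n + 1) * (√(n.choose k : ℝ) * x ^ k) := by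
  obtain ⟨k, hk, h⟩ := Finset.exists_max_image (Finset.range (n + 1))
    (fun k => (√(n.choose k : ℝ) * x ^ k) ^ 2) Finset.nonempty_range_add_one
  refine ⟨k, Nat.lt_succ_iff.1 (Finset.mem_range.1 hk), ?_⟩
  rw [← sqrt_sq (show 0 ≤ √(n.choose k : ℝ) * x ^ k by positivity), ← sqrt_mul (by positivity),
    ← sum_choose_mul_pow]
  refine sqrt_le_sqrt ((Finset.sum_le_card_nsmul _ _ _ h).trans_eq ?_)
  simp

theorem card_le_of_abs_sub_le (s : Finset ℤ) {D : ℝ} (hD : 0 ≤ D)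
    (h : ∀ a ∈ s, ∀ b ∈ s, |(a : ℝ) - b| ≤ D) : (s.card : ℝ) ≤ D + 1 := by
  rcases s.eq_empty_or_nonempty with rfl | hs
  · simp; positivity
  have hsub : s ⊆ Finset.Icc (s.min' hs) (s.max' hs) := fun a ha =>
    Finset.mem_Icc.2 ⟨s.min'_le a ha, s.le_max' a ha⟩
  have h1 := Finset.card_le_card hsub
  have h2 := s.min'_le _ (s.max'_mem hs)
  rw [Int.card_Icc] at h1
  have h3 : (s.card : ℤ) ≤ s.max' hs + 1 - s.min' hs := by omega
  have h4 : (s.card : ℝ) ≤ s.max' hs + 1 - s.min' hs := by exact_mod_cast h3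
  have h5 := (le_abs_self _).trans (h _ (s.max'_mem hs) _ (s.min'_mem hs))
  linarith

open Classical in
/-- Anti-concentration: for a given point `w`, few polynomials in the box are much smaller at `w`
than they can be. Fix all coefficients but the one whose monomial is the largest at `w`; it ranges
over an interval of integers, and being small at `w` confines it to a much shorter one. -/
theorem card_small_le {n : ℕ} (hn : 1 ≤ n) {r : ℝ} (hr : 0 ≤ r) (w : ℂ) (η : ℝ) :
    (((polySet_finite hn r).toFinset.filter fun P =>
      ‖(toC P).eval w‖ < exp (n * (r - η)) * √((1 + ‖w‖ ^ 2) ^ n)).card : ℝ) ≤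
      (2 * exp (-(n * η)) * √(n + 1) + exp (-(n * r))) * (polySet_finite hn r).toFinset.card := by
  set S := (polySet_finite hn r).toFinset with hS
  set t := exp (n * (r - η)) * √((1 + ‖w‖ ^ 2) ^ n) with ht
  set A := S.filter fun P => ‖(toC P).eval w‖ < t with hA
  have hmem : ∀ P, P ∈ S ↔ (∀ k, n < k → P.coeff k = 0) ∧ P.coeff n ≠ 0 ∧
      ∀ k ≤ n, |(P.coeff k : ℝ)| ≤ exp (n * r) * √(n.choose k : ℝ) := fun P => by
    rw [hS, Set.Finite.mem_toFinset, mem_polySet_iff hn]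
  obtain ⟨k, hk, hkw⟩ := exists_large_term n ‖w‖ (norm_nonneg w)
  set H := exp (n * r) * √(n.choose k : ℝ) with hH
  have hch : (1 : ℝ) ≤ √(n.choose k : ℝ) :=
    one_le_sqrt.2 (by exact_mod_cast Nat.choose_pos hk)
  have hwk : 0 < ‖w‖ ^ k := by
    refine (show 0 ≤ ‖w‖ ^ k by positivity).lt_of_ne fun h => ?_
    rw [← h, mul_zero, mul_zero] at hkw
    exact (sqrt_pos.2 (show 0 < (1 + ‖w‖ ^ 2) ^ n by positivity)).not_ge hkw
  have hH1 : 1 ≤ H := one_le_mul_of_one_le_of_one_le (one_le_exp (by positivity)) hch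
  set B := ⌊H⌋₊ with hB
  have hB1 : 1 ≤ B := Nat.le_floor (by simpa using hH1)
  have hHB : H ≤ 2 * B := by
    have h1 := Nat.lt_floor_add_one H
    have h2 : (1 : ℝ) ≤ B := by exact_mod_cast hB1
    linarith
  set D := 2 * t / ‖w‖ ^ k with hD
  have hD0 : 0 ≤ D := by positivity
  -- the fibers of `P ↦ P.erase k` in the box are long
  have hlong : ∀ Q ∈ S.image (fun P => P.erase k),
      2 * B ≤ (S.filter fun P => P.erase k = Q).card := by
    intro Q hQ
    obtain ⟨P₀, hP₀, rfl⟩ := Finset.mem_image.1 hQ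
    obtain ⟨h1, h2, h3⟩ := (hmem P₀).1 hP₀
    have hinj : Function.Injective fun a : ℤ => P₀.erase k + monomial k a := fun a b hab =>
      monomial_injective k (add_left_cancel hab)
    -- the value `0` is left out, as it would lower the degree when `k = n`
    have hcard : ((Finset.Icc (-(B : ℤ)) B).erase 0).card = 2 * B := by
      rw [Finset.card_erase_of_mem (by simp), Int.card_Icc]
      omega
    rw [← hcard, ← Finset.card_image_of_injective _ hinj]
    refine Finset.card_le_card fun P hP => ?_
    obtain ⟨a, ha, rfl⟩ := Finset.mem_image.1 hP
    rw [Finset.mem_erase, Finset.mem_Icc] at ha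
    have hc : ∀ j, (P₀.erase k + monomial k a).coeff j = if j = k then a else P₀.coeff j := by
      intro j
      rw [coeff_add, coeff_erase, coeff_monomial]
      by_cases hj : j = k
      · simp [hj]
      · simp [hj, Ne.symm hj]
    refine Finset.mem_filter.2 ⟨(hmem _).2 ⟨fun j hj => ?_, ?_, fun j hj => ?_⟩, ?_⟩
    · rw [hc, if_neg (by omega), h1 j hj]
    · rw [hc]
      split_ifs
      · exact ha.1
      · exact h2
    · rw [hc]
      split_ifs with h
      · subst h
        have : |a| ≤ B := abs_le.2 ha.2
        have : |(a : ℝ)| ≤ B := by exact_mod_cast this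
        exact this.trans (Nat.floor_le (by positivity))
      · exact h3 j hj
    · ext j
      rw [coeff_erase, hc, coeff_erase]
      split_ifs <;> rfl
  -- the fibers in the set of polynomials that are small at `w` are short
  have hshort : ∀ Q ∈ A.image (fun P => P.erase k),
      (A.filter fun P => P.erase k = Q).card ≤ ⌊D + 1⌋₊ := by
    intro Q _
    have hinj : Set.InjOn (fun P : ℤ[X] => P.coeff k)
        ((A.filter fun P => P.erase k = Q : Finset ℤ[X]) : Set ℤ[X]) := by
      intro P hP P' hP' h
      have e1 := (Finset.mem_filter.1 hP).2
      have e2 := (Finset.mem_filter.1 hP').2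
      rw [← monomial_add_erase P k, ← monomial_add_erase P' k, e1, e2]
      simp only at h
      rw [h]
    rw [← Finset.card_image_of_injOn hinj]
    refine Nat.le_floor (card_le_of_abs_sub_le _ hD0 ?_)
    intro a ha b hb
    obtain ⟨P, hP, rfl⟩ := Finset.mem_image.1 ha
    obtain ⟨P', hP', rfl⟩ := Finset.mem_image.1 hb
    obtain ⟨hP1, hP2⟩ := Finset.mem_filter.1 hP
    obtain ⟨hP1', hP2'⟩ := Finset.mem_filter.1 hP'
    have hev : ∀ P : ℤ[X], (toC P).eval w = (P.coeff k : ℂ) * w ^ k + (toC (P.erase k)).eval w := by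
      intro P
      conv_lhs => rw [← monomial_add_erase P k]
      simp [toC]
    have hlt := (Finset.mem_filter.1 hP1).2
    have hlt' := (Finset.mem_filter.1 hP1').2
    rw [hD, le_div_iff₀ hwk]
    have e : ((P.coeff k : ℂ) - P'.coeff k) * w ^ k = (toC P).eval w - (toC P').eval w := by
      rw [hev P, hev P', hP2, hP2']
      ring
    have e2 : |(P.coeff k : ℝ) - P'.coeff k| = ‖(P.coeff k : ℂ) - P'.coeff k‖ := by
      rw [← norm_eq_abs, ← Complex.norm_real]
      push_cast
      rfl
    rw [e2, ← norm_pow, ← norm_mul, e]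
    linarith [norm_sub_le ((toC P).eval w) ((toC P').eval w)]
  have c1 := Finset.card_le_mul_card_image A _ hshort
  have c2 := Finset.mul_card_image_le_card S _ hlong
  have c3 : (A.image fun P => P.erase k).card ≤ (S.image fun P => P.erase k).card :=
    Finset.card_le_card (Finset.image_subset_image (Finset.filter_subset _ _))
  have hDH : D + 1 ≤ (2 * exp (-(n * η)) * √(n + 1) + exp (-(n * r))) * H := by
    have h1 : D ≤ 2 * exp (-(n * η)) * √(n + 1) * H := by
      rw [hD, div_le_iff₀ hwk, ht, hH, show (n : ℝ) * (r - η) = n * r + -(n * η) by ring, exp_add]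
      calc _ ≤ 2 * (exp (n * r) * exp (-(n * η)) *
            (√(n + 1) * (√(n.choose k : ℝ) * ‖w‖ ^ k))) := by gcongr
        _ = _ := by ring
    have h2 : 1 ≤ exp (-(n * r)) * H := by
      rw [hH, ← mul_assoc, ← exp_add, neg_add_cancel, exp_zero, one_mul]
      exact hch
    linarith
  set q := 2 * exp (-(n * η)) * √(n + 1) + exp (-(n * r)) with hq
  have hq0 : 0 ≤ q := by positivity
  calc (A.card : ℝ) ≤ ⌊D + 1⌋₊ * (S.image fun P => P.erase k).card := by
        exact_mod_cast c1.trans (Nat.mul_le_mul_left _ c3)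
    _ ≤ q * (2 * B) * (S.image fun P => P.erase k).card := by
        gcongr
        exact (Nat.floor_le (by positivity)).trans (hDH.trans (by gcongr))
    _ = q * ((2 * B * (S.image fun P => P.erase k).card : ℕ) : ℝ) := by push_cast; ring
    _ ≤ q * S.card := by gcongr

/-! ### Averages over polynomials of bounded height -/

theorem avg_eq {E : Type*} [AddCommGroup E] [Module ℝ E] {n : ℕ} (hn : 1 ≤ n) (r : ℝ)
    (g : ℤ[X] → E) :
    avg n r g = (1 / ((polySet_finite hn r).toFinset.card : ℝ)) •
      ∑ P ∈ (polySet_finite hn r).toFinset, g P := by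
  rw [avg, Set.ncard_eq_toFinset_card _ (polySet_finite hn r),
    finsum_mem_eq_finite_toFinset_sum _ (polySet_finite hn r)]

theorem avg_le {n : ℕ} (hn : 1 ≤ n) {r : ℝ} {g : ℤ[X] → ℝ} {B : ℝ} (hB0 : 0 ≤ B)
    (h : ∑ P ∈ (polySet_finite hn r).toFinset, g P ≤ (polySet_finite hn r).toFinset.card * B) :
    avg n r g ≤ B := by
  rw [avg_eq hn, smul_eq_mul, one_div]
  rcases (Nat.cast_nonneg (α := ℝ) (polySet_finite hn r).toFinset.card).eq_or_lt with h0 | h0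
  · rw [← h0]; simpa
  · rwa [inv_mul_le_iff₀ h0]

theorem avg_mono {n : ℕ} (hn : 1 ≤ n) {r : ℝ} {g h : ℤ[X] → ℝ}
    (hgh : ∀ P ∈ polySet n r, g P ≤ h P) :
    avg n r g ≤ avg n r h := by
  rw [avg_eq hn, avg_eq hn]
  refine smul_le_smul_of_nonneg_left (Finset.sum_le_sum fun P hP => hgh P ?_) (by positivity)
  simpa using hP

theorem avg_add {n : ℕ} (hn : 1 ≤ n) {r : ℝ} (g h : ℤ[X] → ℝ) :
    avg n r (fun P => g P + h P) = avg n r g + avg n r h := by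
  simp only [avg_eq hn, Finset.sum_add_distrib, smul_add]

theorem avg_const_mul {n : ℕ} (hn : 1 ≤ n) {r : ℝ} (C : ℝ) (g : ℤ[X] → ℝ) :
    avg n r (fun P => C * g P) = C * avg n r g := by
  simp only [avg_eq hn, ← Finset.mul_sum, smul_eq_mul]
  ring

theorem avg_const_le {n : ℕ} (hn : 1 ≤ n) {r : ℝ} {B : ℝ} (hB : 0 ≤ B) :
    avg n r (fun _ => B) ≤ B :=
  avg_le hn hB (by simp)

theorem norm_avg_sub_le {n : ℕ} (hn : 1 ≤ n) {r : ℝ} (hr : 0 ≤ r) (g : ℤ[X] → ℂ) (I : ℂ) :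
    ‖avg n r g - I‖ ≤ avg n r fun P => ‖g P - I‖ := by
  have hne : (polySet_finite hn r).toFinset.card ≠ 0 :=
    Finset.card_ne_zero_of_mem ((Set.Finite.mem_toFinset _).2 (X_pow_mem_polySet hn hr))
  rw [avg_eq hn, avg_eq hn]
  set S := (polySet_finite hn r).toFinset
  have hne' : (S.card : ℝ) ≠ 0 := by exact_mod_cast hne
  have e : (1 / (S.card : ℝ)) • ∑ P ∈ S, g P - I = (1 / (S.card : ℝ)) • ∑ P ∈ S, (g P - I) := by
    rw [Finset.sum_sub_distrib, Finset.sum_const, smul_sub, ← Nat.cast_smul_eq_nsmul ℝ, smul_smul,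
      one_div, inv_mul_cancel₀ hne', one_smul]
  rw [e, norm_smul, smul_eq_mul, norm_of_nonneg (by positivity)]
  gcongr
  exact norm_sum_le _ _

theorem rootMean_logKernel {P : ℂ[X]} (hn : 0 < P.natDegree) :
    Integrable (fun w => rootMean (fun α => logKernel (α - w)) P) ∧
    ∫ w, rootMean (fun α => logKernel (α - w)) P = 2 * π := by
  have h : ∀ s : Multiset ℂ, Integrable (fun w => (s.map fun α => logKernel (α - w)).sum) ∧
      ∫ w, (s.map fun α => logKernel (α - w)).sum = s.card * (2 * π) := by
    intro s
    induction s using Multiset.induction with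
    | empty => simp
    | cons a s ih =>
      have ha : Integrable fun w => logKernel (a - w) := integrable_logKernel.comp_sub_left a
      simp only [Multiset.map_cons, Multiset.sum_cons, Multiset.card_cons]
      refine ⟨ha.add ih.1, ?_⟩
      rw [integral_add ha ih.1, ih.2, integral_sub_left_eq_self logKernel volume a,
        integral_logKernel]
      push_cast
      ring
  obtain ⟨h1, h2⟩ := h P.roots
  refine ⟨h1.div_const _, ?_⟩
  have hn' : (P.natDegree : ℝ) ≠ 0 := by exact_mod_cast hn.ne'
  simp only [rootMean]
  rw [integral_div, h2, card_roots_complex]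
  field_simp

/-- A lower bound for `log |P|` that depends on the roots only through an integrable function, for
polynomials with leading coefficient at least `1` in absolute value. -/
theorem neg_log_norm_eval_le {P : ℂ[X]} (hn : 0 < P.natDegree) (hlc : 1 ≤ ‖P.leadingCoeff‖)
    {w : ℂ} (hw : P.eval w ≠ 0) {T : ℝ} (hT : 0 < T) :
    -(log ‖P.eval w‖ / P.natDegree) ≤ T + 2 / T * rootMean (fun α => logKernel (α - w)) P := by
  have hP : P ≠ 0 := by rintro rfl; simp at hn
  have hn' : (0 : ℝ) < P.natDegree := by exact_mod_cast hn
  have hs : ∀ s : Multiset ℂ, -(s.map fun α => log ‖α - w‖).sum ≤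
      s.card * T + 2 / T * (s.map fun α => logKernel (α - w)).sum := by
    intro s
    induction s using Multiset.induction with
    | empty => simp
    | cons a s ih =>
      simp only [Multiset.map_cons, Multiset.sum_cons, Multiset.card_cons]
      push_cast
      linarith [neg_log_norm_le hT (a - w)]
  have h1 := hs P.roots
  rw [card_roots_complex] at h1
  have h2 := log_nonneg hlc
  rw [log_norm_eval hP hw, rootMean, ← neg_div, div_le_iff₀ hn']
  have e : (T + 2 / T * ((P.roots.map fun α => logKernel (α - w)).sum / P.natDegree)) *
      P.natDegree = P.natDegree * T + 2 / T * (P.roots.map fun α => logKernel (α - w)).sum := by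
    field_simp
  rw [e]
  linarith

/-- The points at which a polynomial of degree `n` is smaller than expected by a factor
`exp (-n η)`. -/
def smallSet (n : ℕ) (r η : ℝ) (P : ℤ[X]) : Set ℂ :=
  {w | ‖(toC P).eval w‖ < exp (n * (r - η)) * √((1 + ‖w‖ ^ 2) ^ n)}

theorem isOpen_smallSet (n : ℕ) (r η : ℝ) (P : ℤ[X]) : IsOpen (smallSet n r η P) :=
  isOpen_lt (by fun_prop) (by fun_prop)

/-- Pointwise bound for the deviation: uniformly small off the exceptional set, and in general
bounded by a constant and a small multiple of an integrable function of mass `2 π`. -/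
theorem abs_deviation_le {n : ℕ} (hn : 1 ≤ n) {r : ℝ} (hr : 0 ≤ r) {P : ℤ[X]}
    (hP : P ∈ polySet n r) {η T R : ℝ} (hη : 0 < η) (hT : 0 < T) {w : ℂ} (hw : ‖w‖ < R)
    (h0 : (toC P).eval w ≠ 0) :
    |deviation r (toC P) w| ≤ (log (n + 1) / (2 * n) + η) +
      (smallSet n r η P).indicator (fun _ => r + log (1 + R ^ 2) / 2 + T) w +
      2 / T * rootMean (fun α => logKernel (α - w)) (toC P) := by
  have hnd : (toC P).natDegree = n := by
    rw [natDegree_toC]; exact natDegree_eq_of_degree_eq_some hP.1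
  have hn0 : (0 : ℝ) < n := by exact_mod_cast hn
  have hup := deviation_le hn hr hP w
  have hlog : 0 ≤ log ((n : ℝ) + 1) / (2 * n) :=
    div_nonneg (log_nonneg (by linarith)) (by positivity)
  have hR : 0 ≤ log (1 + R ^ 2) := log_nonneg (by nlinarith [sq_nonneg R])
  have hK : 0 ≤ 2 / T * rootMean (fun α => logKernel (α - w)) (toC P) := by
    refine mul_nonneg (by positivity) (div_nonneg (Multiset.sum_nonneg fun x hx => ?_)
      (Nat.cast_nonneg _))
    obtain ⟨α, -, rfl⟩ := Multiset.mem_map.1 hx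
    exact logKernel_nonneg _
  have hind : 0 ≤ (smallSet n r η P).indicator (fun _ => r + log (1 + R ^ 2) / 2 + T) w :=
    Set.indicator_nonneg (fun _ _ => by positivity) _
  refine abs_le.2 ⟨?_, by linarith⟩
  by_cases hs : w ∈ smallSet n r η P
  · -- the leading coefficient is a nonzero integer
    have hlc : 1 ≤ ‖(toC P).leadingCoeff‖ := by
      have h1 : (toC P).leadingCoeff = (P.coeff n : ℂ) := by
        rw [leadingCoeff, hnd]; simp [toC]
      rw [h1, Complex.norm_intCast]
      exact_mod_cast Int.one_le_abs ((mem_polySet_iff hn).1 hP).2.1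
    have h1 := neg_log_norm_eval_le (by omega : 0 < (toC P).natDegree) hlc h0 hT
    have h2 : fsPotential w ≤ log (1 + R ^ 2) / 2 := by
      unfold fsPotential
      gcongr
    rw [Set.indicator_of_mem hs, deviation]
    linarith
  · have h1 : exp (n * (r - η)) * √((1 + ‖w‖ ^ 2) ^ n) ≤ ‖(toC P).eval w‖ := not_lt.1 hs
    have h2 := log_le_log (by positivity) h1
    rw [log_mul (by positivity) (by positivity), log_exp, log_sqrt_pow, ← mul_add] at h2
    have h3 : r - η + fsPotential w ≤ log ‖(toC P).eval w‖ / n := by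
      rwa [le_div_iff₀' hn0]
    rw [deviation, hnd]
    linarith

/-- The average of the `L¹`-norm of the deviation on a disc. The middle term is the measure of the
exceptional pairs of a polynomial and a point, estimated by summing over the polynomials first. -/
theorem avg_deviation_le {n : ℕ} (hn : 1 ≤ n) {r : ℝ} (hr : 0 ≤ r) {η T R : ℝ} (hη : 0 < η)
    (hT : 0 < T) (hR : 0 < R) :
    avg n r (fun P => ∫ w in Metric.ball 0 R, |deviation r (toC P) w|) ≤
      π * R ^ 2 * (log (n + 1) / (2 * n) + η) +
      (r + log (1 + R ^ 2) / 2 + T) *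
        (π * R ^ 2 * (2 * exp (-(n * η)) * √(n + 1) + exp (-(n * r)))) +
      2 / T * (2 * π) := by
  set M := r + log (1 + R ^ 2) / 2 + T with hM
  set q := 2 * exp (-(n * η)) * √(n + 1) + exp (-(n * r)) with hq
  set δ := log ((n : ℝ) + 1) / (2 * n) with hδ
  have hδ0 : 0 ≤ δ := div_nonneg (log_nonneg (by
    have := Nat.cast_nonneg (α := ℝ) n; linarith)) (by positivity)
  have hR0 : 0 ≤ log (1 + R ^ 2) := log_nonneg (by nlinarith [sq_nonneg R])
  have hM0 : 0 ≤ M := by positivity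
  have hq0 : 0 ≤ q := by positivity
  set S := (polySet_finite hn r).toFinset with hS
  have hi : ∀ P, IntegrableOn ((smallSet n r η P).indicator fun _ => (1 : ℝ)) (Metric.ball 0 R) :=
    fun P => (integrableOn_ball_const 0 R 1).indicator (isOpen_smallSet n r η P).measurableSet
  have hsingle : ∀ P ∈ S, ∫ w in Metric.ball 0 R, |deviation r (toC P) w| ≤
      π * R ^ 2 * (δ + η) +
      M * (∫ w in Metric.ball 0 R, (smallSet n r η P).indicator (fun _ => (1 : ℝ)) w) +
      2 / T * (2 * π) := by
    intro P hP
    have hP : P ∈ polySet n r := by simpa [hS] using hP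
    have hnd : 0 < (toC P).natDegree := by
      rw [natDegree_toC, natDegree_eq_of_degree_eq_some hP.1]; exact hn
    have hP0 : toC P ≠ 0 := by intro h; simp [h] at hnd
    obtain ⟨k1, k2⟩ := rootMean_logKernel hnd
    have i1 := integrableOn_ball_const 0 R (δ + η)
    have i2 := (hi P).const_mul M
    have i3 : IntegrableOn (fun w => 2 / T * rootMean (fun α => logKernel (α - w)) (toC P))
      (Metric.ball 0 R) := (k1.const_mul _).integrableOn
    have hK : ∀ w, 0 ≤ rootMean (fun α => logKernel (α - w)) (toC P) := fun w => by
      refine div_nonneg (Multiset.sum_nonneg fun x hx => ?_) (Nat.cast_nonneg _)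
      obtain ⟨α, -, rfl⟩ := Multiset.mem_map.1 hx
      exact logKernel_nonneg _
    calc _ ≤ ∫ w in Metric.ball 0 R, ((δ + η) +
          M * (smallSet n r η P).indicator (fun _ => (1 : ℝ)) w +
          2 / T * rootMean (fun α => logKernel (α - w)) (toC P)) := by
          refine setIntegral_mono_on_ae (integrableOn_deviation hnd r 0 R).abs ((i1.add i2).add i3)
            Metric.isOpen_ball.measurableSet ?_
          filter_upwards [ae_eval_ne_zero hP0] with w h0 hw
          have h := abs_deviation_le hn hr hP hη hT (by simpa using hw : ‖w‖ < R) h0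
          refine h.trans_eq ?_
          congr 2
          by_cases hs : w ∈ smallSet n r η P <;> simp [hs, hM]
      _ = π * R ^ 2 * (δ + η) +
          M * (∫ w in Metric.ball 0 R, (smallSet n r η P).indicator (fun _ => (1 : ℝ)) w) +
          2 / T * ∫ w in Metric.ball 0 R, rootMean (fun α => logKernel (α - w)) (toC P) := by
          have i12 : IntegrableOn (fun w => (δ + η) +
            M * (smallSet n r η P).indicator (fun _ => (1 : ℝ)) w) (Metric.ball 0 R) := i1.add i2
          rw [integral_add i12 i3, integral_add i1 i2, setIntegral_ball_const 0 hR.le,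
            integral_const_mul, integral_const_mul]
      _ ≤ _ := by
          gcongr
          rw [← k2]
          exact setIntegral_le_integral k1 (ae_of_all _ hK)
  have hcount : ∑ P ∈ S, ∫ w in Metric.ball 0 R, (smallSet n r η P).indicator (fun _ => (1 : ℝ)) w ≤
      π * R ^ 2 * (q * S.card) := by
    rw [← integral_finsetSum _ fun P _ => hi P, ← setIntegral_ball_const 0 hR.le]
    refine setIntegral_mono (integrable_finsetSum _ fun P _ => hi P)
      (integrableOn_ball_const 0 R _) fun w => ?_
    classical
    refine le_trans (le_of_eq ?_) (card_small_le hn hr w η)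
    rw [Finset.card_filter, Nat.cast_sum]
    refine Finset.sum_congr rfl fun P _ => ?_
    simp [Set.indicator_apply, smallSet]
  refine avg_le hn (by positivity) ?_
  calc _ ≤ ∑ P ∈ S, (π * R ^ 2 * (δ + η) +
      M * (∫ w in Metric.ball 0 R, (smallSet n r η P).indicator (fun _ => (1 : ℝ)) w) +
      2 / T * (2 * π)) := Finset.sum_le_sum hsingle
    _ = S.card * (π * R ^ 2 * (δ + η)) +
      M * (∑ P ∈ S, ∫ w in Metric.ball 0 R, (smallSet n r η P).indicator (fun _ => (1 : ℝ)) w) +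
      S.card * (2 / T * (2 * π)) := by
        rw [Finset.sum_add_distrib, Finset.sum_add_distrib, Finset.sum_const, Finset.sum_const,
          ← Finset.mul_sum, nsmul_eq_mul, nsmul_eq_mul]
    _ ≤ S.card * (π * R ^ 2 * (δ + η)) + M * (π * R ^ 2 * (q * S.card)) +
      S.card * (2 / T * (2 * π)) := by gcongr
    _ = _ := by ring

theorem tendsto_log_succ_div : Tendsto (fun n : ℕ => log ((n : ℝ) + 1) / (2 * n)) atTop (𝓝 0) := by
  have h1 : Tendsto (fun x : ℝ => log x / x) atTop (𝓝 0) :=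
    isLittleO_log_id_atTop.tendsto_div_nhds_zero
  have h2 : Tendsto (fun n : ℕ => (n : ℝ) + 1) atTop atTop :=
    tendsto_atTop_add_const_right _ _ tendsto_natCast_atTop_atTop
  refine squeeze_zero' (Eventually.of_forall fun n => ?_) ?_ (h1.comp h2)
  · exact div_nonneg (log_nonneg (by
      have := Nat.cast_nonneg (α := ℝ) n; linarith)) (by positivity)
  · filter_upwards [eventually_ge_atTop 1] with n hn
    have hn' : (1 : ℝ) ≤ n := by exact_mod_cast hn
    have := log_nonneg (show 1 ≤ (n : ℝ) + 1 by linarith)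
    simp only [Function.comp]
    gcongr
    linarith

theorem tendsto_small_prob {η r₀ : ℝ} (hη : 0 < η) (hr₀ : 0 < r₀) :
    Tendsto (fun n : ℕ => 2 * exp (-(n * η)) * √(n + 1) + exp (-(n * r₀))) atTop (𝓝 0) := by
  have hlin : ∀ a : ℝ, 0 < a → Tendsto (fun n : ℕ => (n : ℝ) * a) atTop atTop := fun a ha =>
    tendsto_natCast_atTop_atTop.atTop_mul_const ha
  have h1 : Tendsto (fun n : ℕ => exp (-(n * r₀))) atTop (𝓝 0) :=
    tendsto_exp_neg_atTop_nhds_zero.comp (hlin r₀ hr₀)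
  have h2 : Tendsto (fun n : ℕ => 2 * exp (-(n * η)) * √(n + 1)) atTop (𝓝 0) := by
    have h3 : Tendsto (fun n : ℕ => 2 / η * ((n * η) * exp (-(n * η))) + 2 * exp (-(n * η)))
        atTop (𝓝 0) := by
      have a := (tendsto_pow_mul_exp_neg_atTop_nhds_zero 1).comp (hlin η hη)
      have b := tendsto_exp_neg_atTop_nhds_zero.comp (hlin η hη)
      have := (a.const_mul (2 / η)).add (b.const_mul 2)
      simpa [Function.comp_def] using this
    refine squeeze_zero (fun n => by positivity) (fun n => ?_) h3
    have h4 : √((n : ℝ) + 1) ≤ n + 1 := by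
      rw [sqrt_le_left (by positivity)]
      nlinarith [Nat.cast_nonneg (α := ℝ) n]
    calc _ ≤ 2 * exp (-(n * η)) * (n + 1) := by gcongr
      _ = _ := by field_simp
  simpa using h2.add h1

/-- On average over the polynomials of bounded height, `(1/n) log |P|` is close in `L¹` to its
expected value on every disc. -/
theorem tendsto_avg_deviation {r : ℕ → ℝ} {r₀ r₁ : ℝ} (hr₀ : 0 < r₀)
    (hr : ∀ᶠ n in atTop, r₀ ≤ r n ∧ r n ≤ r₁) (R : ℝ) :
    Tendsto (fun n => avg n (r n) fun P => ∫ w in Metric.ball 0 R, |deviation (r n) (toC P) w|)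
      atTop (𝓝 0) := by
  rcases le_or_gt R 0 with hR | hR
  · simp [Metric.ball_eq_empty.2 hR, avg]
  rw [Metric.tendsto_nhds]
  intro ε hε
  have hπ := pi_pos
  -- In the bound of `avg_deviation_le`, the choices of `T` and `η` make the terms that do not
  -- depend on `n` equal to `ε / 4` each.
  set T := 16 * π / ε with hT
  have hT0 : 0 < T := by positivity
  set η := ε / (4 * π * R ^ 2) with hη
  have hη0 : 0 < η := by positivity
  have hlim : Tendsto (fun n : ℕ => π * R ^ 2 * (log (n + 1) / (2 * n) + η) +
      (r₁ + log (1 + R ^ 2) / 2 + T) *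
        (π * R ^ 2 * (2 * exp (-(n * η)) * √(n + 1) + exp (-(n * r₀)))) +
      2 / T * (2 * π)) atTop (𝓝 (ε / 2)) := by
    have h := (((tendsto_log_succ_div.add_const η).const_mul (π * R ^ 2)).add
      (((tendsto_small_prob hη0 hr₀).const_mul (π * R ^ 2)).const_mul
        (r₁ + log (1 + R ^ 2) / 2 + T))).add_const (2 / T * (2 * π))
    convert h using 2
    rw [hη, hT]
    field_simp
    ring
  filter_upwards [hr, hlim.eventually (gt_mem_nhds (half_lt_self hε)), eventually_ge_atTop 1]
    with n ⟨h1, h2⟩ h3 hn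
  have h0 : 0 ≤ avg n (r n) fun P => ∫ w in Metric.ball 0 R, |deviation (r n) (toC P) w| := by
    rw [avg_eq hn, smul_eq_mul]
    positivity
  rw [dist_zero_right, norm_of_nonneg h0]
  refine ((avg_deviation_le hn (hr₀.le.trans h1) hη0 hT0 hR).trans ?_).trans_lt h3
  have hR0 : 0 ≤ log (1 + R ^ 2) := log_nonneg (by nlinarith [sq_nonneg R])
  have := hr₀.le.trans h1
  have : 0 ≤ r₁ + log (1 + R ^ 2) / 2 + T := by linarith
  gcongr

/-- A nonnegative statistic that is dominated, up to an arbitrarily small error, by the `L¹`-norm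
of the deviation on discs tends to `0` on average. -/
theorem tendsto_avg_zero_of_le {r : ℕ → ℝ} {r₀ r₁ : ℝ} (hr₀ : 0 < r₀)
    (hr : ∀ᶠ n in atTop, r₀ ≤ r n ∧ r n ≤ r₁) {g : ℤ[X] → ℝ} (hg : ∀ P, 0 ≤ g P)
    (h : ∀ ε > 0, ∃ C R C' R' : ℝ, ∀ᶠ n in atTop, ∀ P ∈ polySet n (r n), g P ≤
      ε + C * (∫ w in Metric.ball 0 R, |deviation (r n) (toC P) w|) +
        C' * ∫ w in Metric.ball 0 R', |deviation (r n) (toC P) w|) :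
    Tendsto (fun n => avg n (r n) g) atTop (𝓝 0) := by
  rw [Metric.tendsto_nhds]
  intro ε hε
  obtain ⟨C, R, C', R', hC⟩ := h (ε / 2) (by positivity)
  have hlim := ((tendsto_avg_deviation hr₀ hr R).const_mul C).const_add (ε / 2) |>.add
    ((tendsto_avg_deviation hr₀ hr R').const_mul C')
  simp only [mul_zero, add_zero] at hlim
  filter_upwards [hC, hlim.eventually (gt_mem_nhds (half_lt_self hε)), eventually_ge_atTop 1]
    with n h1 h2 hn
  have h0 : 0 ≤ avg n (r n) g := by
    rw [avg_eq hn, smul_eq_mul]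
    exact mul_nonneg (by positivity) (Finset.sum_nonneg fun P _ => hg P)
  rw [dist_zero_right, norm_of_nonneg h0]
  refine ((avg_mono hn h1).trans ?_).trans_lt h2
  rw [avg_add hn, avg_add hn, avg_const_mul hn, avg_const_mul hn]
  gcongr
  exact avg_const_le hn (by positivity)

theorem natDegree_toC_pos {n : ℕ} (hn : 1 ≤ n) {r : ℝ} {P : ℤ[X]} (hP : P ∈ polySet n r) :
    0 < (toC P).natDegree := by
  rw [natDegree_toC, natDegree_eq_of_degree_eq_some hP.1]
  exact hn

theorem tendsto_avg_hFS {r : ℕ → ℝ} {τ : ℝ} (hτ : 0 < τ) (hr : Tendsto r atTop (𝓝 τ)) :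
    Tendsto (fun n => avg n (r n) fun P => |τ + 1 / 2 - hFS (toC P)|) atTop (𝓝 0) := by
  have hb : ∀ᶠ n in atTop, τ / 2 ≤ r n ∧ r n ≤ τ + 1 := by
    filter_upwards [hr.eventually (lt_mem_nhds (half_lt_self hτ)),
      hr.eventually (gt_mem_nhds (lt_add_one τ))] with n h1 h2 using ⟨h1.le, h2.le⟩
  refine tendsto_avg_zero_of_le (half_pos hτ) hb (fun P => abs_nonneg _) fun ε hε => ?_
  obtain ⟨C, R, hCR⟩ := abs_hFS_sub_le (half_pos hε)
  refine ⟨C, R, 1 / π, 1, ?_⟩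
  filter_upwards [eventually_ge_atTop 1, hr.eventually (Metric.ball_mem_nhds τ (half_pos hε))]
    with n hn hrn P hP
  have h1 := hCR (toC P) (r n) (natDegree_toC_pos hn hP)
  have h2 : |τ - r n| < ε / 2 := by
    rwa [dist_comm, dist_eq] at hrn
  have h3 := abs_add_le (τ - r n) (r n + 1 / 2 - hFS (toC P))
  rw [show τ - r n + (r n + 1 / 2 - hFS (toC P)) = τ + 1 / 2 - hFS (toC P) by ring] at h3
  linarith

theorem tendsto_avg_norm_zeroMean_sub {r : ℕ → ℝ} {r₀ r₁ : ℝ} (hr₀ : 0 < r₀)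
    (hr : ∀ᶠ n in atTop, r₀ ≤ r n ∧ r n ≤ r₁) {f : ℂ → ℂ} (hf : IsControlled f) :
    Tendsto (fun n => avg n (r n) fun P => ‖zeroMean f (toC P) - fubiniStudyIntegral f‖)
      atTop (𝓝 0) := by
  refine tendsto_avg_zero_of_le hr₀ hr (fun P => norm_nonneg _) fun ε hε => ?_
  obtain ⟨C, R, hCR⟩ := hf ε hε
  refine ⟨C, R, 0, 0, ?_⟩
  filter_upwards [eventually_ge_atTop 1] with n hn P hP
  simpa using hCR (toC P) (r n) (natDegree_toC_pos hn hP)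

theorem exists_bounds {r : ℕ → ℝ} (h1 : 0 < liminf (fun n : ℕ => (r n : EReal)) atTop)
    (h2 : limsup (fun n : ℕ => (r n : EReal)) atTop < ⊤) :
    ∃ r₀ r₁ : ℝ, 0 < r₀ ∧ ∀ᶠ n in atTop, r₀ ≤ r n ∧ r n ≤ r₁ := by
  obtain ⟨a, ha0, ha⟩ := EReal.lt_iff_exists_real_btwn.1 h1
  obtain ⟨b, hb, -⟩ := EReal.lt_iff_exists_real_btwn.1 h2
  refine ⟨a, b, by exact_mod_cast ha0, ?_⟩
  filter_upwards [eventually_lt_of_lt_liminf ha, eventually_lt_of_limsup_lt hb] with n h3 h4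
  exact ⟨by exact_mod_cast h3.le, by exact_mod_cast h4.le⟩

end Equidistribution

end PolyHeight

theorem corollary1p8 (r : ℕ → ℝ) :
    (∀ τ : ℝ, 0 < τ → Tendsto r atTop (𝓝 τ) →
      Tendsto (fun n : ℕ => PolyHeight.avg n (r n) fun P =>
        |τ + 1 / 2 - PolyHeight.hFS (PolyHeight.toC P)|) atTop (𝓝 0)) ∧
    (0 < liminf (fun n : ℕ => (r n : EReal)) atTop →
      limsup (fun n : ℕ => (r n : EReal)) atTop < ⊤ →
      ∀ f : ℂ → ℂ, Continuous f → (∃ L : ℂ, Tendsto f (cocompact ℂ) (𝓝 L)) →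
        Tendsto (fun n : ℕ => PolyHeight.avg n (r n) fun P =>
          ‖PolyHeight.zeroMean f (PolyHeight.toC P) - PolyHeight.fubiniStudyIntegral f‖)
          atTop (𝓝 0) ∧
        Tendsto (fun n : ℕ => PolyHeight.avg n (r n) fun P =>
          PolyHeight.zeroMean f (PolyHeight.toC P))
          atTop (𝓝 (PolyHeight.fubiniStudyIntegral f))) := by
  refine ⟨fun τ hτ hr => PolyHeight.tendsto_avg_hFS hτ hr, fun h1 h2 f hf ⟨L, hL⟩ => ?_⟩
  obtain ⟨r₀, r₁, hr₀, hr⟩ := PolyHeight.exists_bounds h1 h2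
  have key := PolyHeight.tendsto_avg_norm_zeroMean_sub hr₀ hr
    (PolyHeight.isControlled_of_tendsto hf hL)
  refine ⟨key, tendsto_iff_norm_sub_tendsto_zero.2 ?_⟩
  refine squeeze_zero' (Eventually.of_forall fun n => norm_nonneg _) ?_ key
  filter_upwards [hr, eventually_ge_atTop 1] with n hn h
  exact PolyHeight.norm_avg_sub_le h (hr₀.le.trans hn.1) _ _
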